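/- Let $M$ be a connected, Hausdorff, second-countable smooth $n$-manifold, let $\mathcal F$ be a smooth foliation of $M$ of codimension $q$, $2\le q<n$, and let $g_\intercal$ be a Lorentzian transverse metric for $\mathcal F$: a smooth symmetric $(0,2)$-tensor field on $M$ with $g_\intercal(V,\cdot)=0$ and $\mathcal L_Vg_\intercal=0$ for every vector field $V$ tangent to $\mathcal F$, which induces a nondegenerate form of index $1$ on each $T_xM/T_x\mathcal F$. A vector $v$ is transversely timelike if $g_\intercal(v,v)<0$; the timewedges at $x$ are the two connected components of the set of transversely timelike vectors in $T_xM$. Fix a transverse time-orientation, i.e. a smoothly varying choice of a (future) timewedge at each point. A future-directed transversely timelike curve is a piecewise smooth curve $\alpha:[a,b]\to M$, $a<b$, all of whose (one-sided) velocities lie in the future timewedges. A set is saturated if it is a union of leaves; $L_x$ is the leaf through $x$. The transverse closure $\overline{A}^\intercal$ is the closure of $A$ in the topology of saturated open sets, and $A$ is transversely closed if $A=\overline{A}^\intercal$. For a saturated set $A$, $I^+_\intercal(A)$ [resp. $I^-_\intercal(A)$] is the set of points $y$ for which some future-directed transversely timelike curve goes from a point of $A$ to a point of $L_y$ [resp.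 from a point of $L_y$ to a point of $A$]; for a saturated open set $\mathcal U\supset A$, $I^\pm_\intercal(A,\mathcal U)$ is defined in the same way with curves contained in $\mathcal U$. A set $A\subset M$ is transversely achronal if no future-directed transversely timelike curve starts and ends in $A$. Its transverse edge $\mathrm{edge}_\intercal(A)$ is the set of $x\in\overline{A}^\intercal$ such that, for every saturated open $\mathcal U\ni x$, some future-directed transversely timelike curve contained in $\mathcal U$ goes from $I^-_\intercal(L_x,\mathcal U)$ to $I^+_\intercal(L_x,\mathcal U)$ without meeting $A$. A set $S\subset M$ is a $C^0$ hypersurface if every $p\in S$ has an open neighbourhood $O$ in $M$ with a homeomorphism of $O$ onto an open set of $\mathbb R^n$ carrying $O\cap S$ onto the intersection of that open set with an affine hyperplane (so $\emptyset$ is a $C^0$ hypersurface). **Theorem.** (1) If $A\subset M$ is transversely achronal and $\mathrm{edge}_\intercal(A)=\emptyset$, then $A$ is transversely closed, hence saturated, and is a $C^0$ hypersurface. (2) In particular, for every saturated set $A\subset M$, each of the boundaries $\partial I^+_\intercal(A)$ and $\partial I^-_\intercal(A)$ (in the manifold topology) is transversely achronal with empty transverse edge, and is therefore a transversely closed, saturated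 $C^0$ hypersurface. -/

import Mathlib

open Set Topology
open scoped Manifold ContDiff

/-- The model space `ℝᵏ`. -/
abbrev RSpace (k : ℕ) : Type := EuclideanSpace ℝ (Fin k)

/-- `X` is a smooth vector field on the set `O` (used for open `O`). -/
def IsSmoothFieldOn {n : ℕ} {M : Type*} [TopologicalSpace M] [ChartedSpace (RSpace n) M]
    [IsManifold (𝓡 n) ∞ M] (X : ∀ x : M, TangentSpace (𝓡 n) x) (O : Set M) : Prop :=
  ContMDiffOn (𝓡 n) (𝓡 n).tangent ∞ (fun y => (⟨y, X y⟩ : TangentBundle (𝓡 n) M)) O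

/-- The derivative `v f` of a function `f` in the direction of the tangent vector `v` at `x`. -/
noncomputable def dirDeriv {n : ℕ} {M : Type*} [TopologicalSpace M] [ChartedSpace (RSpace n) M]
    (f : M → ℝ) (x : M) (v : TangentSpace (𝓡 n) x) : ℝ :=
  mfderiv (𝓡 n) 𝓘(ℝ, ℝ) f x v

/-- A `C⁰` (topological) hypersurface of `M`: around each of its points there is a homeomorphism
of an open set of `M` onto an open set of `ℝⁿ` carrying the set to a piece of a hyperplane
`{v | ℓ v = c}`, `ℓ ≠ 0`. -/
def IsC0Hypersurface (n : ℕ) {M : Type*} [TopologicalSpace M] (S : Set M) : Prop :=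
  ∀ p ∈ S, ∃ φ : OpenPartialHomeomorph M (RSpace n), p ∈ φ.source ∧
    ∃ (ℓ : RSpace n →L[ℝ] ℝ) (c : ℝ), ℓ ≠ 0 ∧ ∀ y ∈ φ.source, (y ∈ S ↔ ℓ (φ y) = c)

/-- A codimension `q` foliation of the smooth `n`-manifold `M`, given by a Haefliger cocycle:
an open cover `U i`, submersions `π i : U i → ℝ^q`, and smooth transition maps `γ i j` from
`π j (U i ∩ U j)` to `π i (U i ∩ U j)` with `γ i j ∘ π j = π i` on `U i ∩ U j`.
(`γ i j` and `γ j i` are then mutually inverse, so the transition maps are diffeomorphisms.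
Values of `π i` and `γ i j` outside the indicated sets are irrelevant.) -/
structure FoliationCocycle (ι : Type*) (n q : ℕ) (M : Type*) [TopologicalSpace M]
    [ChartedSpace (RSpace n) M] [IsManifold (𝓡 n) ∞ M] where
  U : ι → Set M
  isOpen_U : ∀ i, IsOpen (U i)
  cover : ∀ x, ∃ i, x ∈ U i
  π : ι → M → RSpace q
  submersion : ∀ i, ∀ x ∈ U i, Manifold.IsSubmersionAt (𝓡 n) (𝓡 q) ∞ (π i) x
  γ : ι → ι → RSpace q → RSpace q
  contDiffOn_γ : ∀ i j, ContDiffOn ℝ ∞ (γ i j) (π j '' (U i ∩ U j))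
  γ_comp : ∀ i j, ∀ x ∈ U i ∩ U j, γ i j (π j x) = π i x

namespace FoliationCocycle

variable {ι : Type*} {n q : ℕ} {M : Type*} [TopologicalSpace M]
  [ChartedSpace (RSpace n) M] [IsManifold (𝓡 n) ∞ M]

/-- The plaque of the simple open set `U i` through `x ∈ U i`: the connected component of `x` in
the fibre of `π i : U i → ℝ^q` through `x`. -/
def plaque (F : FoliationCocycle ι n q M) (i : ι) (x : M) : Set M :=
  connectedComponentIn {y | y ∈ F.U i ∧ F.π i y = F.π i x} x

/-- Two points are on the same leaf iff they are joined by a finite chain of plaques. -/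
def leafSetoid (F : FoliationCocycle ι n q M) : Setoid M :=
  Relation.EqvGen.setoid (fun x y => ∃ i, y ∈ F.plaque i x)

/-- The leaf space `M/F`. -/
def LeafSpace (F : FoliationCocycle ι n q M) : Type _ := Quotient F.leafSetoid

/-- The projection `M → M/F`; `F.leaf x` is the leaf through `x`, as a point of `M/F`. -/
def leaf (F : FoliationCocycle ι n q M) (x : M) : F.LeafSpace := Quotient.mk F.leafSetoid x

/-- Saturated sets: unions of leaves. -/
def IsSaturated (F : FoliationCocycle ι n q M) (A : Set M) : Prop :=
  F.leaf ⁻¹' (F.leaf '' A) = A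

theorem isSaturated_iff (F : FoliationCocycle ι n q M) (A : Set M) :
    F.IsSaturated A ↔ ∀ x ∈ A, ∀ y, F.leaf x = F.leaf y → y ∈ A := by
  constructor
  · intro h x hx y hxy
    rw [← h]
    exact ⟨x, hx, hxy⟩
  · intro h
    apply Subset.antisymm
    · rintro y ⟨x, hx, hxy⟩
      exact h x hx y hxy
    · exact subset_preimage_image _ _

/-- The topology on `M` whose open sets are the saturated open sets of `M`. -/
@[reducible] def saturatedTopology (F : FoliationCocycle ι n q M) : TopologicalSpace M where
  IsOpen A := IsOpen A ∧ F.IsSaturated A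
  isOpen_univ := by simp [isSaturated_iff]
  isOpen_inter A B hA hB := by
    refine ⟨hA.1.inter hB.1, ?_⟩
    rw [isSaturated_iff]
    intro x hx y hxy
    exact ⟨(F.isSaturated_iff A).1 hA.2 x hx.1 y hxy, (F.isSaturated_iff B).1 hB.2 x hx.2 y hxy⟩
  isOpen_sUnion S hS := by
    refine ⟨isOpen_sUnion fun A hA => (hS A hA).1, ?_⟩
    rw [isSaturated_iff]
    rintro x ⟨A, hA, hx⟩ y hxy
    exact ⟨A, hA, (F.isSaturated_iff A).1 (hS A hA).2 x hx y hxy⟩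

/-- The transverse closure: closure in the topology of saturated open sets. -/
def transverseClosure (F : FoliationCocycle ι n q M) (A : Set M) : Set M :=
  @closure M F.saturatedTopology A

/-- Transversely closed sets. -/
def IsTransverselyClosed (F : FoliationCocycle ι n q M) (A : Set M) : Prop :=
  F.transverseClosure A = A

/-- The tangent space `T_xF` of the leaf through `x`: the kernel of the differential at `x` of any
submersion `π i` with `x ∈ U i` (all of them have the same kernel). -/
noncomputable def tangent (F : FoliationCocycle ι n q M) (x : M) : Submodule ℝ (TangentSpace (𝓡 n) x) :=
  ⨅ (i : ι) (_ : x ∈ F.U i), (mfderiv (𝓡 n) (𝓡 q) (F.π i) x).toLinearMap.ker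

/-- A Lorentzian transverse metric for the foliation: a smooth symmetric `(0,2)`-tensor field `g` on
`M` which is basic (it annihilates vertical vectors and its Lie derivative along vertical fields
vanishes) and induces a nondegenerate form of index `1` on each `T_xM / T_xF`. -/
structure LorentzMetric (F : FoliationCocycle ι n q M) where
  val : ∀ x : M, TangentSpace (𝓡 n) x →L[ℝ] TangentSpace (𝓡 n) x →L[ℝ] ℝ
  contMDiff : ContMDiff (𝓡 n) ((𝓡 n).prod 𝓘(ℝ, RSpace n →L[ℝ] RSpace n →L[ℝ] ℝ)) ∞
    (fun x => Bundle.TotalSpace.mk' (RSpace n →L[ℝ] RSpace n →L[ℝ] ℝ)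
      (E := fun x : M => TangentSpace (𝓡 n) x →L[ℝ] TangentSpace (𝓡 n) x →L[ℝ] ℝ) x (val x))
  symm : ∀ (x : M) (v w : TangentSpace (𝓡 n) x), val x v w = val x w v
  /-- The radical is exactly `T_xF`: vertical vectors are annihilated, and the form induced on
  `T_xM / T_xF` is nondegenerate. -/
  radical : ∀ (x : M) (v : TangentSpace (𝓡 n) x), (∀ w, val x v w = 0) ↔ v ∈ F.tangent x
  /-- The index is `1`. (Negative definite subspaces of `T_xM` meet the radical trivially, so the
  index of `val x` is that of the form induced on `T_xM / T_xF`.) -/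
  index_eq_one : ∀ x : M,
    _root_.sigNeg (LinearMap.BilinMap.toQuadraticMap (val x).toBilinForm) = 1
  /-- `(L_V g)(X, Y) = V (g (X, Y)) - g ([V, X], Y) - g (X, [V, Y]) = 0` for vertical `V`. -/
  lie_eq_zero : ∀ O : Set M, IsOpen O → ∀ V X Y : (∀ x : M, TangentSpace (𝓡 n) x),
    IsSmoothFieldOn V O → IsSmoothFieldOn X O → IsSmoothFieldOn Y O →
    (∀ x ∈ O, V x ∈ F.tangent x) → ∀ x ∈ O,
      dirDeriv (fun y => val y (X y) (Y y)) x (V x)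
        - val x (VectorField.mlieBracket (𝓡 n) V X x) (Y x)
        - val x (X x) (VectorField.mlieBracket (𝓡 n) V Y x) = 0

namespace LorentzMetric

variable {F : FoliationCocycle ι n q M}

/-- The set of transversely timelike vectors at `x`. -/
def timelike (g : F.LorentzMetric) (x : M) : Set (TangentSpace (𝓡 n) x) :=
  {v | g.val x v v < 0}

/-- The timewedges at `x` are the connected components of the set of transversely timelike vectors
at `x`. -/
def IsTimewedge (g : F.LorentzMetric) (x : M) (W : Set (TangentSpace (𝓡 n) x)) : Prop :=
  ∃ u ∈ g.timelike x, W = connectedComponentIn (g.timelike x) u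

/-- A transverse time-orientation: a choice of a (future) timewedge at each point which varies
smoothly, i.e. locally contains a smooth vector field. -/
structure TimeOrientation (g : F.LorentzMetric) where
  future : ∀ x : M, Set (TangentSpace (𝓡 n) x)
  isTimewedge : ∀ x, g.IsTimewedge x (future x)
  smooth : ∀ x : M, ∃ O : Set M, IsOpen O ∧ x ∈ O ∧
    ∃ X : ∀ y : M, TangentSpace (𝓡 n) y, IsSmoothFieldOn X O ∧ ∀ y ∈ O, X y ∈ future y

namespace TimeOrientation

variable {g : F.LorentzMetric}

/-- `α : [a, b] → M`, `a < b`, is a future-directed transversely timelike piecewise smooth curve: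
there is a subdivision `a = t 0 < ⋯ < t k = b` such that `α` is smooth on each closed
subinterval, with all its velocities there (one-sided at the ends) in the future timewedge. -/
def IsTimelikeCurve (T : g.TimeOrientation) (α : ℝ → M) (a b : ℝ) : Prop :=
  a < b ∧ ∃ (k : ℕ) (t : ℕ → ℝ), t 0 = a ∧ t k = b ∧ ∀ i < k, t i < t (i + 1) ∧
    ContMDiffOn 𝓘(ℝ, ℝ) (𝓡 n) ∞ α (Icc (t i) (t (i + 1))) ∧
    ∀ s ∈ Icc (t i) (t (i + 1)),
      mfderivWithin 𝓘(ℝ, ℝ) (𝓡 n) α (Icc (t i) (t (i + 1))) s (1 : ℝ) ∈ T.future (α s)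

/-- The chronological relation between leaves, for the foliation restricted to the (saturated open)
set `W`: some future-directed transversely timelike curve in `W` runs from `L₁` to `L₂`. -/
def Chron (T : g.TimeOrientation) (W : Set M) (L₁ L₂ : F.LeafSpace) : Prop :=
  ∃ (α : ℝ → M) (a b : ℝ), T.IsTimelikeCurve α a b ∧ (∀ s ∈ Icc a b, α s ∈ W) ∧
    F.leaf (α a) = L₁ ∧ F.leaf (α b) = L₂

/-- The transverse chronological future, relative to `W`, of (the saturated set) `A`. -/
def chronFuture (T : g.TimeOrientation) (W A : Set M) : Set M :=
  F.leaf ⁻¹' {L' | ∃ L ∈ F.leaf '' A, T.Chron W L L'}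

/-- The transverse chronological past, relative to `W`, of (the saturated set) `A`. -/
def chronPast (T : g.TimeOrientation) (W A : Set M) : Set M :=
  F.leaf ⁻¹' {L' | ∃ L ∈ F.leaf '' A, T.Chron W L' L}

/-- `A` is transversely achronal: no transversely timelike curve joins two points of `A`. -/
def IsAchronal (T : g.TimeOrientation) (A : Set M) : Prop :=
  ¬ ∃ (α : ℝ → M) (a b : ℝ), T.IsTimelikeCurve α a b ∧ α a ∈ A ∧ α b ∈ A

/-- The transverse edge of `A`: the points `x` of the transverse closure such that in every saturated
open neighbourhood `W` of `x` some future-directed transversely timelike curve goes from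
`I⁻(L_x, W)` to `I⁺(L_x, W)` without meeting `A`. -/
def edge (T : g.TimeOrientation) (A : Set M) : Set M :=
  {x | x ∈ F.transverseClosure A ∧ ∀ W : Set M, IsOpen W → F.IsSaturated W → x ∈ W →
    ∃ (α : ℝ → M) (a b : ℝ), T.IsTimelikeCurve α a b ∧ (∀ s ∈ Icc a b, α s ∈ W) ∧
      α a ∈ T.chronPast W (F.leaf ⁻¹' {F.leaf x}) ∧
      α b ∈ T.chronFuture W (F.leaf ⁻¹' {F.leaf x}) ∧
      ∀ s ∈ Icc a b, α s ∉ A}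

end TimeOrientation

end LorentzMetric

end FoliationCocycle

/-! In a chart adapted to a submersion `π i`, the fibres lie in translates of a linear subspace `K`.
Because the transverse metric annihilates vertical vectors and has zero Lie derivative along
vertical fields, its coefficients do not change along `K`. The future timewedges therefore become an
open cone field that is invariant when the base point or the vector is moved along `K`. The causal
arguments use only this structure (`ConeChart`, `isBasicConeField`). Bending the initial bit of a
timelike curve inside such a chart (`exists_reach`) shows that reachability is an open relation
depending only on leaves (`IsOpenLeafRelation`).

Pasts and futures of points are thus saturated and open, so achronality passes from `A` to its
transverse closure. A point of the closure outside `A` is then unrelated to `A`. A short timelike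
segment through it misses `A`, making it an edge point, so an empty edge forces `A` to be
transversely closed. Near a point of `A`, an empty edge makes every short segment in a fixed
timelike direction `v` meet `A`, and achronality makes the meeting height unique and Lipschitz. Thus
`A` is a graph, flattened by a shear along `v`.

For the boundary of a future, openness and transitivity give achronality. A curve from the past to
the future of a boundary leaf starts outside the future set and ends in it, so it crosses the
boundary by connectedness. The past is the future for the reversed relation. -/

set_option linter.unusedSectionVars false

/-! ### Curves of a cone field, adapted charts, time reversal. -/

namespace FoliationCocycle

variable {ι : Type*} {n q : ℕ} {M : Type*} [TopologicalSpace M]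
  [ChartedSpace (RSpace n) M] [IsManifold (𝓡 n) ∞ M]

/-- `α` restricted to `[a, b]`, `a < b`, is a smooth curve with all velocities in `Fut`. -/
def IsPiece (Fut : ∀ x : M, Set (TangentSpace (𝓡 n) x)) (α : ℝ → M) (a b : ℝ) : Prop :=
  a < b ∧ ContMDiffOn 𝓘(ℝ, ℝ) (𝓡 n) ∞ α (Icc a b) ∧
    ∀ s ∈ Icc a b, mfderivWithin 𝓘(ℝ, ℝ) (𝓡 n) α (Icc a b) s (1 : ℝ) ∈ Fut (α s)

/-- `x` and `y` are joined by a smooth curve with velocities in `Fut`. -/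
def Piece (Fut : ∀ x : M, Set (TangentSpace (𝓡 n) x)) (x y : M) : Prop :=
  ∃ α a b, IsPiece Fut α a b ∧ α a = x ∧ α b = y

/-- `x` and `y` are joined by a piecewise smooth curve with velocities in `Fut`. -/
def Reach (Fut : ∀ x : M, Set (TangentSpace (𝓡 n) x)) : M → M → Prop :=
  Relation.TransGen (Piece Fut)

/-- The opposite cone field. -/
def negCone (Fut : ∀ x : M, Set (TangentSpace (𝓡 n) x)) : ∀ x : M, Set (TangentSpace (𝓡 n) x) :=
  fun x => {v | -v ∈ Fut x}

/-- A chart, adapted to the submersion `π i`, in which the cone field `Fut` is an open set of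
pairs (point, vector) which is invariant under translations along the fibres. -/
structure ConeChart (F : FoliationCocycle ι n q M)
    (Fut : ∀ x : M, Set (TangentSpace (𝓡 n) x)) (i : ι) where
  φ : OpenPartialHomeomorph M (RSpace n)
  smooth : ContMDiffOn (𝓡 n) (𝓡 n) ∞ φ φ.source
  smooth_symm : ContMDiffOn (𝓡 n) (𝓡 n) ∞ φ.symm φ.target
  convex : Convex ℝ φ.target
  K : Submodule ℝ (RSpace n)
  sub_mem : ∀ y ∈ φ.source, ∀ y' ∈ φ.source, F.π i y = F.π i y' → φ y - φ y' ∈ K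
  C : Set (RSpace n × RSpace n)
  isOpen_C : IsOpen C
  mem_cone : ∀ y ∈ φ.source, ∀ v : TangentSpace (𝓡 n) y,
    v ∈ Fut y ↔ (φ y, (mfderiv (𝓡 n) (𝓡 n) φ y v : RSpace n)) ∈ C
  add_mem : ∀ x v k k', (x, v) ∈ C → x ∈ φ.target → x + k ∈ φ.target → k ∈ K → k' ∈ K →
    (x + k, v + k') ∈ C
  smul_mem : ∀ x v, ∀ c : ℝ, 0 < c → x ∈ φ.target → (x, v) ∈ C → (x, c • v) ∈ C
  ne_zero : ∀ x v, x ∈ φ.target → (x, v) ∈ C → v ≠ 0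
  nonempty : ∀ x ∈ φ.target, ∃ v, (x, v) ∈ C

/-- The cone field `Fut` has adapted charts in arbitrarily small neighbourhoods of each point. -/
def IsBasicConeField (F : FoliationCocycle ι n q M)
    (Fut : ∀ x : M, Set (TangentSpace (𝓡 n) x)) : Prop :=
  ∀ i, ∀ p ∈ F.U i, ∀ O ∈ 𝓝 p, ∃ c : ConeChart F Fut i, p ∈ c.φ.source ∧ c.φ.source ⊆ O

variable {F : FoliationCocycle ι n q M} {Fut : ∀ x : M, Set (TangentSpace (𝓡 n) x)}

namespace ConeChart

/-- A chart adapted to a cone field is adapted to the opposite one. -/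
def neg {i : ι} (c : ConeChart F Fut i) : ConeChart F (negCone Fut) i where
  φ := c.φ
  smooth := c.smooth
  smooth_symm := c.smooth_symm
  convex := c.convex
  K := c.K
  sub_mem := c.sub_mem
  C := {z | (z.1, -z.2) ∈ c.C}
  isOpen_C := c.isOpen_C.preimage (by fun_prop)
  mem_cone y hy v := by
    refine (c.mem_cone y hy (-v)).trans ?_
    rw [map_neg]
    rfl
  add_mem x v k k' h hx hxk hk hk' := by
    have := c.add_mem x (-v) k (-k') h hx hxk hk (neg_mem hk')
    rwa [← neg_add] at this
  smul_mem x v t ht hx h := by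
    have := c.smul_mem x (-v) t ht hx h
    rwa [smul_neg] at this
  ne_zero x v hx h := neg_ne_zero.1 (c.ne_zero x (-v) hx h)
  nonempty x hx := by
    obtain ⟨v, hv⟩ := c.nonempty x hx
    exact ⟨-v, by simpa using hv⟩

theorem mdifferentiableAt {i : ι} (c : ConeChart F Fut i) {y : M} (hy : y ∈ c.φ.source) :
    MDifferentiableAt (𝓡 n) (𝓡 n) c.φ y :=
  (c.smooth.contMDiffAt (c.φ.open_source.mem_nhds hy)).mdifferentiableAt (by simp)

theorem mdifferentiableAt_symm {i : ι} (c : ConeChart F Fut i) {x : RSpace n}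
    (hx : x ∈ c.φ.target) : MDifferentiableAt (𝓡 n) (𝓡 n) c.φ.symm x :=
  (c.smooth_symm.contMDiffAt (c.φ.open_target.mem_nhds hx)).mdifferentiableAt (by simp)

theorem mfderiv_comp_symm {i : ι} (c : ConeChart F Fut i) {x : RSpace n}
    (hx : x ∈ c.φ.target) (v : RSpace n) :
    (mfderiv (𝓡 n) (𝓡 n) c.φ (c.φ.symm x) (mfderiv (𝓡 n) (𝓡 n) c.φ.symm x v) : RSpace n) = v := by
  have hd : c.φ.MDifferentiable (𝓡 n) (𝓡 n) :=
    ⟨c.smooth.mdifferentiableOn (by simp), c.smooth_symm.mdifferentiableOn (by simp)⟩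
  have := hd.comp_symm_deriv hx
  exact DFunLike.congr_fun this v

/-- A straight segment of the chart with direction in the cones is a curve of the cone field. -/
theorem isPiece_segment {i : ι} (c : ConeChart F Fut i) {x w : RSpace n} {a b : ℝ} (hab : a < b)
    (h : ∀ t ∈ Icc a b, x + t • w ∈ c.φ.target ∧ (x + t • w, w) ∈ c.C) :
    IsPiece Fut (fun t => c.φ.symm (x + t • w)) a b := by
  have hl : ContMDiff 𝓘(ℝ, ℝ) (𝓡 n) ∞ (fun t : ℝ => x + t • w) :=
    ContDiff.contMDiff (by fun_prop)
  refine ⟨hab, c.smooth_symm.comp hl.contMDiffOn fun t ht => (h t ht).1, fun s hs => ?_⟩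
  have hu : UniqueMDiffWithinAt 𝓘(ℝ, ℝ) (Icc a b) s :=
    (uniqueDiffOn_Icc hab).uniqueMDiffOn s hs
  have h1 : mfderivWithin 𝓘(ℝ, ℝ) (𝓡 n) (c.φ.symm ∘ fun t : ℝ => x + t • w) (Icc a b) s =
      (mfderiv (𝓡 n) (𝓡 n) c.φ.symm (x + s • w)).comp
        (mfderivWithin 𝓘(ℝ, ℝ) (𝓡 n) (fun t : ℝ => x + t • w) (Icc a b) s) :=
    mfderiv_comp_mfderivWithin s (c.mdifferentiableAt_symm (h s hs).1)
      (hl.mdifferentiable (by simp) s).mdifferentiableWithinAt hu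
  have h2 : (mfderivWithin 𝓘(ℝ, ℝ) (𝓡 n) (fun t : ℝ => x + t • w) (Icc a b) s) (1 : ℝ) = w := by
    rw [mfderivWithin_eq_fderivWithin]
    have : HasDerivWithinAt (fun t : ℝ => x + t • w) w (Icc a b) s := by
      simpa using (((hasDerivAt_id s).smul_const w).const_add x).hasDerivWithinAt
    have h3 := this.derivWithin (uniqueDiffOn_Icc hab s hs)
    rw [← fderivWithin_derivWithin] at h3
    exact h3
  have h4 : (mfderivWithin 𝓘(ℝ, ℝ) (𝓡 n) (fun t => c.φ.symm (x + t • w)) (Icc a b) s (1 : ℝ) :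
      RSpace n) = mfderiv (𝓡 n) (𝓡 n) c.φ.symm (x + s • w) w :=
    (DFunLike.congr_fun h1 (1 : ℝ)).trans
      (congrArg (mfderiv (𝓡 n) (𝓡 n) c.φ.symm (x + s • w)) h2)
  have h5 : (mfderiv (𝓡 n) (𝓡 n) c.φ (c.φ.symm (x + s • w))
      (mfderivWithin 𝓘(ℝ, ℝ) (𝓡 n) (fun t => c.φ.symm (x + t • w)) (Icc a b) s (1 : ℝ)) :
      RSpace n) = w :=
    (congrArg (mfderiv (𝓡 n) (𝓡 n) c.φ (c.φ.symm (x + s • w))) h4).trans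
      (c.mfderiv_comp_symm (h s hs).1 w)
  refine (c.mem_cone _ (c.φ.map_target (h s hs).1) _).2 ?_
  have h6 := (h s hs).2
  rw [← c.φ.right_inv (h s hs).1] at h6
  exact (congrArg (fun z => (c.φ (c.φ.symm (x + s • w)), z) ∈ c.C) h5).mpr h6

theorem piece_of_segment {i : ι} (c : ConeChart F Fut i) {x x' : RSpace n}
    (h : ∀ t ∈ Icc (0 : ℝ) 1, x + t • (x' - x) ∈ c.φ.target ∧ (x + t • (x' - x), x' - x) ∈ c.C) :
    Piece Fut (c.φ.symm x) (c.φ.symm x') :=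
  ⟨_, 0, 1, c.isPiece_segment zero_lt_one h, by simp, by simp⟩

end ConeChart

theorem IsBasicConeField.neg (h : IsBasicConeField F Fut) :
    IsBasicConeField F (negCone Fut) := fun i p hp O hO => by
  obtain ⟨c, h1, h2⟩ := h i p hp O hO
  exact ⟨c.neg, h1, h2⟩

theorem negCone_negCone : negCone (negCone Fut) = Fut := by
  funext x
  ext v
  simp [negCone]

theorem IsPiece.subinterval {α : ℝ → M} {a b a' b' : ℝ} (h : IsPiece Fut α a b) (ha : a ≤ a')
    (hab : a' < b') (hb : b' ≤ b) : IsPiece Fut α a' b' := by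
  have hsub : Icc a' b' ⊆ Icc a b := Icc_subset_Icc ha hb
  refine ⟨hab, h.2.1.mono hsub, fun s hs => ?_⟩
  have hu : UniqueMDiffWithinAt 𝓘(ℝ, ℝ) (Icc a' b') s :=
    (uniqueDiffOn_Icc hab).uniqueMDiffOn s hs
  rw [mfderivWithin_subset hsub hu (h.2.1.mdifferentiableOn (by simp) s (hsub hs))]
  exact h.2.2 s (hsub hs)

/-- Serves both time reversal (`e = -1`) and translation of the parameter (`e = 1`). The forms `-1 *
r + 0` and `1 * r + (a - c)` used for those curves are chosen to match it. -/
theorem mfderivWithin_comp_affine {α : ℝ → M} {s t : Set ℝ} {e c u : ℝ}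
    (hα : MDifferentiableWithinAt 𝓘(ℝ, ℝ) (𝓡 n) α t (e * u + c))
    (hst : MapsTo (fun r => e * r + c) s t) (hs : UniqueMDiffWithinAt 𝓘(ℝ, ℝ) s u) :
    mfderivWithin 𝓘(ℝ, ℝ) (𝓡 n) (fun r => α (e * r + c)) s u (1 : ℝ) =
      e • mfderivWithin 𝓘(ℝ, ℝ) (𝓡 n) α t (e * u + c) (1 : ℝ) := by
  have hl : ContMDiff 𝓘(ℝ, ℝ) 𝓘(ℝ, ℝ) ∞ (fun r : ℝ => e * r + c) :=
    ContDiff.contMDiff (by fun_prop)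
  have h1 := mfderivWithin_comp u hα
    (hl.mdifferentiable (by simp) u).mdifferentiableWithinAt hst hs
  have h2 : (mfderivWithin 𝓘(ℝ, ℝ) 𝓘(ℝ, ℝ) (fun r : ℝ => e * r + c) s u) (1 : ℝ) = e := by
    rw [mfderivWithin_eq_fderivWithin]
    have : HasDerivWithinAt (fun r : ℝ => e * r + c) e s u := by
      simpa using (((hasDerivAt_id u).const_mul e).add_const c).hasDerivWithinAt
    have h3 := this.derivWithin hs.uniqueDiffWithinAt
    rw [← fderivWithin_derivWithin] at h3
    exact h3
  have h3 : ∀ L : ℝ →L[ℝ] RSpace n, L e = e • L 1 := fun L => by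
    rw [← map_smul, smul_eq_mul, mul_one]
  exact (DFunLike.congr_fun h1 (1 : ℝ)).trans
    ((congrArg (mfderivWithin 𝓘(ℝ, ℝ) (𝓡 n) α t (e * u + c)) h2).trans (h3 _))

theorem IsPiece.reverse {α : ℝ → M} {a b : ℝ} (h : IsPiece Fut α a b) :
    IsPiece (negCone Fut) (fun r => α (-1 * r + 0)) (-b) (-a) := by
  have hab : -b < -a := neg_lt_neg h.1
  have hm : MapsTo (fun r : ℝ => -1 * r + 0) (Icc (-b) (-a)) (Icc a b) := by
    rintro r ⟨h1, h2⟩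
    constructor <;> simp <;> linarith
  have hl : ContMDiff 𝓘(ℝ, ℝ) 𝓘(ℝ, ℝ) ∞ (fun r : ℝ => -1 * r + 0) :=
    ContDiff.contMDiff (by fun_prop)
  refine ⟨hab, h.2.1.comp hl.contMDiffOn hm, fun s hs => ?_⟩
  change -_ ∈ Fut _
  rw [mfderivWithin_comp_affine (h.2.1.mdifferentiableOn (by simp) _ (hm hs)) hm
    ((uniqueDiffOn_Icc hab).uniqueMDiffOn s hs), neg_smul, one_smul, neg_neg]
  exact h.2.2 _ (hm hs)

theorem Piece.reverse {x y : M} (h : Piece Fut x y) : Piece (negCone Fut) y x := by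
  obtain ⟨α, a, b, h, rfl, rfl⟩ := h
  exact ⟨_, _, _, h.reverse, by simp, by simp⟩

theorem piece_negCone {x y : M} : Piece (negCone Fut) x y ↔ Piece Fut y x :=
  ⟨fun h => by simpa only [negCone_negCone] using h.reverse, Piece.reverse⟩

/-- Time duality: each statement about initial points of curves yields the one about final points,
applied to the opposite cone field. -/
theorem reach_negCone {x y : M} : Reach (negCone Fut) x y ↔ Reach Fut y x := by
  have : Piece (negCone Fut) = Function.swap (Piece Fut) := by
    funext x y
    exact propext piece_negCone
  rw [Reach, this, Relation.transGen_swap, Reach]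

end FoliationCocycle

/-! ### Reachability is open and depends only on leaves. -/

namespace FoliationCocycle

variable {ι : Type*} {n q : ℕ} {M : Type*} [TopologicalSpace M]
  [ChartedSpace (RSpace n) M] [IsManifold (𝓡 n) ∞ M]
  {F : FoliationCocycle ι n q M} {Fut : ∀ x : M, Set (TangentSpace (𝓡 n) x)}

namespace ConeChart

variable {i : ι}

/-- Around a point of the cones of a chart, `C` contains a product of balls. -/
theorem exists_ball (c : ConeChart F Fut i) {x v : RSpace n} (hx : x ∈ c.φ.target)
    (h : (x, v) ∈ c.C) :
    ∃ r > 0, Metric.ball x r ⊆ c.φ.target ∧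
      ∀ z ∈ Metric.ball x r, ∀ w ∈ Metric.ball v r, (z, w) ∈ c.C := by
  obtain ⟨r₁, h₁, hr₁⟩ := Metric.isOpen_iff.1 c.φ.open_target x hx
  obtain ⟨r₂, h₂, hr₂⟩ := Metric.isOpen_iff.1 c.isOpen_C _ h
  refine ⟨min r₁ r₂, lt_min h₁ h₂,
    (Metric.ball_subset_ball (min_le_left _ _)).trans hr₁, fun z hz w hw => hr₂ ?_⟩
  rw [← ball_prod_same]
  exact ⟨Metric.ball_subset_ball (min_le_right _ _) hz,
    Metric.ball_subset_ball (min_le_right _ _) hw⟩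

/-- The velocity of a curve of the cone field at its starting point, in a chart. -/
theorem exists_hasDerivWithinAt (c : ConeChart F Fut i) {α : ℝ → M} {a b : ℝ}
    (h : IsPiece Fut α a b) (ha : α a ∈ c.φ.source) :
    ∃ v, (c.φ (α a), v) ∈ c.C ∧ HasDerivWithinAt (fun s => c.φ (α s)) v (Icc a b) a := by
  have haI : a ∈ Icc a b := left_mem_Icc.2 h.1.le
  have h1 := (c.mdifferentiableAt ha).hasMFDerivAt.comp_hasMFDerivWithinAt a
    (h.2.1.mdifferentiableOn (by simp) a haI).hasMFDerivWithinAt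
  have h2 : ∀ L : ℝ →L[ℝ] RSpace n,
      HasMFDerivWithinAt 𝓘(ℝ, ℝ) (𝓡 n) (fun s => c.φ (α s)) (Icc a b) a L →
      HasDerivWithinAt (fun s => c.φ (α s)) (L 1) (Icc a b) a := fun L hL => by
    have h3 : HasFDerivWithinAt (fun s => c.φ (α s)) L (Icc a b) a :=
      hasMFDerivWithinAt_iff_hasFDerivWithinAt.1 hL
    exact h3.hasDerivWithinAt
  exact ⟨_, (c.mem_cone _ ha _).1 (h.2.2 a haI), h2 _ h1⟩

/-- A curve of the cone field ending at `y` may be started at any point which is close, up to a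
translation along the leaves, to its starting point. -/
theorem exists_reach (c : ConeChart F Fut i) {x y : M} (h : Piece Fut x y)
    (hx : x ∈ c.φ.source) :
    ∃ δ > 0, ∀ x' ∈ c.φ.source, ∀ k ∈ c.K, dist (c.φ x' + k) (c.φ x) < δ → Reach Fut x' y := by
  obtain ⟨α, a, b, h, rfl, rfl⟩ := h
  obtain ⟨v, hv, hd⟩ := c.exists_hasDerivWithinAt h hx
  obtain ⟨r, hr, hrt, hrC⟩ := c.exists_ball (c.φ.map_source hx) hv
  have hcont : Filter.Tendsto (fun s => c.φ (α s)) (𝓝[>] a) (𝓝 (c.φ (α a))) :=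
    hd.continuousWithinAt.tendsto.mono_left
      (by rw [← nhdsWithin_Ioc_eq_nhdsGT h.1]; exact nhdsWithin_mono _ Ioc_subset_Icc_self)
  have hsrc : Filter.Tendsto α (𝓝[>] a) (𝓝 (α a)) :=
    (h.2.1.continuousOn a (left_mem_Icc.2 h.1.le)).tendsto.mono_left
      (by rw [← nhdsWithin_Ioc_eq_nhdsGT h.1]; exact nhdsWithin_mono _ Ioc_subset_Icc_self)
  rw [hasDerivWithinAt_iff_tendsto_slope, Icc_sdiff_left, nhdsWithin_Ioc_eq_nhdsGT h.1] at hd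
  -- A time `s` just after `a`, at which the chord from the starting point has mean velocity within
  -- `r / 2` of `v`. The other `r / 2` is left for moving the starting point.
  obtain ⟨s, ⟨⟨hs1, hs2⟩, hs3⟩, hs4⟩ :=
    (((hcont.eventually (Metric.ball_mem_nhds _ hr)).and
      (hd.eventually (Metric.ball_mem_nhds _ (half_pos hr)))).and
      (hsrc.eventually (c.φ.open_source.mem_nhds hx))).and
      (Ioo_mem_nhdsGT h.1) |>.exists
  have hε : 0 < s - a := sub_pos.2 hs4.1
  refine ⟨min r ((s - a) * (r / 2)), lt_min hr (by positivity), fun x' hx' k hk hdist => ?_⟩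
  have hz : c.φ x' + k ∈ Metric.ball (c.φ (α a)) r := hdist.trans_le (min_le_left _ _)
  have hvel : (s - a)⁻¹ • (c.φ (α s) - (c.φ x' + k)) ∈ Metric.ball v r := by
    have h1 : (s - a)⁻¹ • (c.φ (α s) - (c.φ x' + k)) =
        slope (fun s => c.φ (α s)) a s + (s - a)⁻¹ • (c.φ (α a) - (c.φ x' + k)) := by
      rw [slope_def_module, ← smul_add, sub_add_sub_cancel]
    have h2 : ‖(s - a)⁻¹ • (c.φ (α a) - (c.φ x' + k))‖ < r / 2 := by
      rw [norm_smul, Real.norm_of_nonneg (by positivity), inv_mul_lt_iff₀ hε, ← dist_eq_norm,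
        dist_comm]
      exact hdist.trans_le (min_le_right _ _)
    rw [h1, Metric.mem_ball, dist_eq_norm, add_sub_right_comm]
    rw [dist_eq_norm] at hs2
    calc _ ≤ _ := norm_add_le _ _
      _ < r / 2 + r / 2 := add_lt_add hs2 h2
      _ = r := add_halves r
  -- The segment from `φ x' + k` to `φ (α s)` has its direction in the cones. Translating its point
  -- at time `t` by `(t - 1) • k`, and its velocity by `k`, turns it into the segment from `φ x'` to
  -- the same end, and invariance along `K` keeps it in the cones.
  have hseg : Piece Fut (c.φ.symm (c.φ x')) (c.φ.symm (c.φ (α s))) := by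
    refine c.piece_of_segment fun t ht => ?_
    have hmem := c.convex.add_smul_sub_mem (c.φ.map_source hx') (c.φ.map_source hs3) ht
    refine ⟨hmem, ?_⟩
    have hb := (convex_ball (c.φ (α a)) r).add_smul_sub_mem hz hs1 ht
    have hC := c.smul_mem _ _ _ hε (hrt hb) (hrC _ hb _ hvel)
    rw [smul_inv_smul₀ hε.ne'] at hC
    have e1 : c.φ x' + k + t • (c.φ (α s) - (c.φ x' + k)) + (t - 1) • k =
      c.φ x' + t • (c.φ (α s) - c.φ x') := by module
    have e2 : c.φ (α s) - (c.φ x' + k) + k = c.φ (α s) - c.φ x' := by module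
    have hC' := c.add_mem _ _ ((t - 1) • k) k hC (hrt hb) (by rwa [e1]) (c.K.smul_mem _ hk) hk
    rwa [e1, e2] at hC'
  rw [c.φ.left_inv hx', c.φ.left_inv hs3] at hseg
  exact (Relation.TransGen.single hseg).tail
    ⟨α, s, b, h.subinterval hs4.1.le hs4.2 le_rfl, rfl, rfl⟩

end ConeChart

namespace IsBasicConeField

/-- Only the first piece of a chain has to be bent: this is `exists_reach` with `k = 0`. -/
theorem isOpen_reach_to (h : IsBasicConeField F Fut) (y : M) : IsOpen {x | Reach Fut x y} := by
  rw [isOpen_iff_mem_nhds]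
  intro x hx
  obtain ⟨z, hxz, hzy⟩ := Relation.TransGen.head'_iff.1 hx
  obtain ⟨i, hi⟩ := F.cover x
  obtain ⟨c, hc, -⟩ := h i x hi univ Filter.univ_mem
  obtain ⟨δ, hδ, H⟩ := c.exists_reach hxz hc
  filter_upwards [c.φ.open_source.mem_nhds hc,
    (c.φ.continuousAt hc).preimage_mem_nhds (Metric.ball_mem_nhds _ hδ)] with x' h1 h2
  exact (H x' h1 0 c.K.zero_mem (by simpa using h2)).trans_left hzy

theorem isOpen_reach_from (h : IsBasicConeField F Fut) (x : M) : IsOpen {y | Reach Fut x y} := by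
  simpa only [reach_negCone] using h.neg.isOpen_reach_to x

end IsBasicConeField

/-- An equivalence relation which locally contains the fibres of the submersions contains the
relation of being on the same leaf. -/
theorem of_leaf_eq {E : M → M → Prop} (hE : Equivalence E)
    (hloc : ∀ i, ∀ p ∈ F.U i, ∃ N ∈ 𝓝 p, ∀ y ∈ N, ∀ y' ∈ N, F.π i y = F.π i y' → E y y')
    {x x' : M} (h : F.leaf x = F.leaf x') : E x x' := by
  have h' : Relation.EqvGen (fun x y => ∃ i, y ∈ F.plaque i x) x x' := Quotient.exact h
  refine hE.eqvGen_iff.1 (h'.mono fun y z hz => ?_)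
  obtain ⟨i, hz⟩ := hz
  have hy : y ∈ {w | w ∈ F.U i ∧ F.π i w = F.π i y} :=
    connectedComponentIn_nonempty_iff.1 ⟨z, hz⟩
  have hsub := connectedComponentIn_subset {w | w ∈ F.U i ∧ F.π i w = F.π i y} y
  -- A plaque is connected and the classes of `E` are locally constant along it, so it lies in one
  -- class.
  refine isPreconnected_connectedComponentIn.induction₂ E (fun w hw => ?_)
    (fun _ _ _ _ _ _ => hE.trans) (fun _ _ _ _ => hE.symm) (mem_connectedComponentIn hy) hz
  obtain ⟨N, hN, H⟩ := hloc i w (hsub hw).1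
  filter_upwards [mem_nhdsWithin_of_mem_nhds hN, self_mem_nhdsWithin] with w' hw' hw''
  exact H w (mem_of_mem_nhds hN) w' hw' ((hsub hw).2.trans (hsub hw'').2.symm)

namespace IsBasicConeField

/-- It suffices to move `x` within a fibre inside one chart. There `k = φ w - φ w'` lies in `K`, and
the distance required by `exists_reach` is `0`, whatever `δ` is. -/
theorem reach_congr_left (h : IsBasicConeField F Fut) {x x' : M} (hx : F.leaf x = F.leaf x')
    (y : M) : Reach Fut x y ↔ Reach Fut x' y := by
  refine of_leaf_eq (F := F) (E := fun x x' => (Reach Fut x y ↔ Reach Fut x' y))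
    ⟨fun _ => Iff.rfl, Iff.symm, Iff.trans⟩ (fun i p hp => ?_) hx
  obtain ⟨c, hc, -⟩ := h i p hp univ Filter.univ_mem
  have key : ∀ w ∈ c.φ.source, ∀ w' ∈ c.φ.source, F.π i w = F.π i w' →
      Reach Fut w y → Reach Fut w' y := fun w hw w' hw' hπ hr => by
    obtain ⟨z, hwz, hzy⟩ := Relation.TransGen.head'_iff.1 hr
    obtain ⟨δ, hδ, H⟩ := c.exists_reach hwz hw
    exact (H w' hw' _ (c.sub_mem w hw w' hw' hπ) (by simpa using hδ)).trans_left hzy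
  exact ⟨c.φ.source, c.φ.open_source.mem_nhds hc, fun w hw w' hw' hπ =>
    ⟨key w hw w' hw' hπ, key w' hw' w hw hπ.symm⟩⟩

theorem reach_congr_right (h : IsBasicConeField F Fut) {y y' : M} (hy : F.leaf y = F.leaf y')
    (x : M) : Reach Fut x y ↔ Reach Fut x y' := by
  simpa only [reach_negCone] using h.neg.reach_congr_left hy x

end IsBasicConeField

end FoliationCocycle

/-! ### Linear algebra of forms of index one. -/

/-- For a symmetric form of index `1`, timelike vectors are never orthogonal. -/
theorem apply_ne_zero_of_sigNeg_eq_one {V : Type*} [AddCommGroup V] [Module ℝ V]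
    [FiniteDimensional ℝ V] (B : LinearMap.BilinForm ℝ V) (hs : ∀ v w, B v w = B w v)
    (hi : _root_.sigNeg (LinearMap.BilinMap.toQuadraticMap B) = 1) {v w : V}
    (hv : B v v < 0) (hw : B w w < 0) : B v w ≠ 0 := by
  intro h0
  have h0' : B w v = 0 := by rw [hs, h0]
  have hli : LinearIndependent ℝ ![v, w] := by
    rw [LinearIndependent.pair_iff]
    intro s t hst
    have h1 := congrArg (B v) hst
    have h2 := congrArg (B w) hst
    simp only [map_add, map_smul, smul_eq_mul, map_zero, h0, h0', mul_zero, add_zero, zero_add,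
      mul_eq_zero, hv.ne, hw.ne, or_false] at h1 h2
    exact ⟨h1, h2⟩
  -- Two orthogonal timelike vectors would span a negative definite plane, forcing the index to be
  -- at least `2`.
  have hpos : ((-LinearMap.BilinMap.toQuadraticMap B).restrict
      (Submodule.span ℝ (range ![v, w]))).PosDef := by
    rintro ⟨x, hx⟩ hne
    rw [Matrix.range_cons, Matrix.range_cons, Matrix.range_empty, union_empty,
      singleton_union, Submodule.mem_span_pair] at hx
    obtain ⟨a, b, rfl⟩ := hx
    have hab : ¬ (a = 0 ∧ b = 0) := by
      rintro ⟨rfl, rfl⟩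
      exact hne (by simp)
    change 0 < -(B (a • v + b • w) (a • v + b • w))
    simp only [map_add, map_smul, LinearMap.add_apply, LinearMap.smul_apply, smul_eq_mul, h0, h0',
      mul_zero, add_zero, zero_add]
    rcases not_and_or.1 hab with h | h <;> have := pow_pos (abs_pos.2 h) 2 <;>
      rw [sq_abs] at this <;>
      nlinarith [sq_nonneg a, sq_nonneg b, mul_nonneg (sq_nonneg a) (neg_pos.2 hv).le,
        mul_nonneg (sq_nonneg b) (neg_pos.2 hw).le, mul_pos this (neg_pos.2 hv),
        mul_pos this (neg_pos.2 hw)]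
  have h2 := le_sigNeg_of_negDef (LinearMap.BilinMap.toQuadraticMap B) hpos
  rw [hi, finrank_span_eq_card hli] at h2
  simp at h2

/-- The connected components of the timelike vectors of a symmetric form of index `1`. -/
theorem connectedComponentIn_timelike {V : Type*} [AddCommGroup V] [Module ℝ V]
    [TopologicalSpace V] [IsTopologicalAddGroup V] [ContinuousSMul ℝ V] [FiniteDimensional ℝ V]
    (B : V →L[ℝ] V →L[ℝ] ℝ) (hs : ∀ v w, B v w = B w v)
    (hi : _root_.sigNeg (LinearMap.BilinMap.toQuadraticMap B.toBilinForm) = 1) {u : V}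
    (hu : B u u < 0) :
    connectedComponentIn {v | B v v < 0} u = {v | B v v < 0 ∧ B v u < 0} := by
  have hne : ∀ {v w : V}, B v v < 0 → B w w < 0 → B v w ≠ 0 := fun hv hw =>
    apply_ne_zero_of_sigNeg_eq_one B.toBilinForm hs hi hv hw
  have hu' : u ∈ {v | B v v < 0} := hu
  apply Subset.antisymm
  · intro v hv
    have hsub := connectedComponentIn_subset {v | B v v < 0} u
    refine ⟨hsub hv, ?_⟩
    by_contra! hpos
    rw [hs] at hpos
    -- If `B u` changed sign on the component it would vanish at a timelike vector, which would then
    -- be orthogonal to `u`.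
    have hivt : Icc (B u u) (B u v) ⊆ B u '' connectedComponentIn {v | B v v < 0} u :=
      isPreconnected_connectedComponentIn.intermediate_value
        (mem_connectedComponentIn hu') hv (B u).continuous.continuousOn
    obtain ⟨w, hw, hw0⟩ := hivt ⟨hu.le, hpos⟩
    exact hne hu (hsub hw) hw0
  · rintro v ⟨hv, hvu⟩
    -- Expanding `B` on a convex combination of `u` and `v` gives only nonpositive terms, not all
    -- zero, so the whole segment is timelike.
    have hpc : IsPreconnected (segment ℝ u v) := (convex_segment u v).isPreconnected
    refine hpc.subset_connectedComponentIn (left_mem_segment ℝ u v) ?_ (right_mem_segment ℝ u v)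
    rintro _ ⟨a, b, ha, hb, hab, rfl⟩
    have huv : B u v < 0 := by rwa [hs]
    change B (a • u + b • v) (a • u + b • v) < 0
    simp only [map_add, map_smul, add_apply, smul_apply, smul_eq_mul]
    rcases ha.eq_or_lt with rfl | ha'
    · have : b = 1 := by linarith
      subst this
      simpa using hv
    · nlinarith [mul_nonneg hb (neg_pos.2 hvu).le, mul_nonneg hb (neg_pos.2 huv).le,
        mul_nonneg (mul_nonneg ha hb) (neg_pos.2 hvu).le,
        mul_nonneg (mul_nonneg ha hb) (neg_pos.2 huv).le,
        mul_pos (mul_pos ha' ha') (neg_pos.2 hu), mul_nonneg (mul_nonneg hb hb) (neg_pos.2 hv).le]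

/-! ### Vertical vectors, constant coordinate fields, coefficients of the metric. -/

namespace FoliationCocycle

variable {ι : Type*} {n q : ℕ} {M : Type*} [TopologicalSpace M]
  [ChartedSpace (RSpace n) M] [IsManifold (𝓡 n) ∞ M]
  {F : FoliationCocycle ι n q M}

/-- `F.tangent` intersects the kernels for all indices, but near `y` each `π j` is `γ j i ∘ π i`, so
one kernel is contained in all the others. -/
theorem mem_tangent {i : ι} {y : M} (hy : y ∈ F.U i) {e : TangentSpace (𝓡 n) y}
    (he : (mfderiv (𝓡 n) (𝓡 q) (F.π i) y e : RSpace q) = 0) : e ∈ F.tangent y := by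
  simp only [tangent, Submodule.mem_iInf]
  intro j hj
  have hopen : F.U j ∩ F.U i ∈ 𝓝 y := ((F.isOpen_U j).inter (F.isOpen_U i)).mem_nhds ⟨hj, hy⟩
  have hπ : MDifferentiableWithinAt (𝓡 n) (𝓡 q) (F.π i) (F.U j ∩ F.U i) y :=
    ((F.submersion i y hy).contMDiffAt.mdifferentiableAt (by simp)).mdifferentiableWithinAt
  have hγ : MDifferentiableWithinAt (𝓡 q) (𝓡 q) (F.γ j i) (F.π i '' (F.U j ∩ F.U i)) (F.π i y) :=
    (((F.contDiffOn_γ j i) _ (mem_image_of_mem _ ⟨hj, hy⟩)).differentiableWithinAt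
      (by simp)).mdifferentiableWithinAt
  have hc := (HasMFDerivWithinAt.comp y hγ.hasMFDerivWithinAt hπ.hasMFDerivWithinAt
    (subset_preimage_image _ _)).hasMFDerivAt hopen
  have heq : F.π j =ᶠ[𝓝 y] F.γ j i ∘ F.π i := by
    filter_upwards [hopen] with z hz using (F.γ_comp j i z hz).symm
  have h1 := (hc.congr_of_eventuallyEq heq).mfderiv
  rw [mfderivWithin_of_mem_nhds hopen] at h1
  change mfderiv (𝓡 n) (𝓡 q) (F.π j) y e = 0
  have h2 := DFunLike.congr_fun h1 e
  refine h2.trans ?_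
  refine (congrArg (mfderivWithin (𝓡 q) (𝓡 q) (F.γ j i) (F.π i '' (F.U j ∩ F.U i)) (F.π i y))
    he).trans ?_
  exact map_zero _

end FoliationCocycle

namespace FoliationCocycle

variable {ι : Type*} {n q : ℕ} {M : Type*} [TopologicalSpace M]
  [ChartedSpace (RSpace n) M] [IsManifold (𝓡 n) ∞ M]
  {F : FoliationCocycle ι n q M}

/-- The vector field which is constant, equal to `v`, in the chart `φ`. -/
noncomputable def coordField (φ : OpenPartialHomeomorph M (RSpace n)) (v : RSpace n) :
    ∀ x : M, TangentSpace (𝓡 n) x :=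
  VectorField.mpullback (𝓡 n) (𝓡 n) φ (fun _ => v)

section coordField

variable {φ : OpenPartialHomeomorph M (RSpace n)}
  (hφ : φ ∈ IsManifold.maximalAtlas (𝓡 n) ∞ M)

include hφ in
theorem mdifferentiable_of_mem_maximalAtlas : φ.MDifferentiable (𝓡 n) (𝓡 n) :=
  ⟨(contMDiffOn_of_mem_maximalAtlas hφ).mdifferentiableOn (by simp),
    (contMDiffOn_symm_of_mem_maximalAtlas hφ).mdifferentiableOn (by simp)⟩

include hφ in
theorem isInvertible_mfderiv_chart {y : M} (hy : y ∈ φ.source) :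
    (mfderiv (𝓡 n) (𝓡 n) φ y).IsInvertible :=
  ⟨(mdifferentiable_of_mem_maximalAtlas hφ).mfderiv hy, rfl⟩

include hφ in
theorem mfderiv_coordField {y : M} (hy : y ∈ φ.source) (v : RSpace n) :
    mfderiv (𝓡 n) (𝓡 n) φ y (coordField φ v y) = v :=
  (isInvertible_mfderiv_chart hφ hy).self_apply_inverse v

include hφ in
theorem coordField_mfderiv {y : M} (hy : y ∈ φ.source) (e : TangentSpace (𝓡 n) y) :
    coordField φ (mfderiv (𝓡 n) (𝓡 n) φ y e) y = e :=
  (isInvertible_mfderiv_chart hφ hy).inverse_apply_self e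

include hφ in
theorem mfderiv_symm_eq_coordField {x : RSpace n} (hx : x ∈ φ.target) (v : RSpace n) :
    mfderiv (𝓡 n) (𝓡 n) φ.symm x v = coordField φ v (φ.symm x) := by
  have h1 := DFunLike.congr_fun
    ((mdifferentiable_of_mem_maximalAtlas hφ).comp_symm_deriv hx) v
  have h2 := coordField_mfderiv hφ (φ.map_target hx) (mfderiv (𝓡 n) (𝓡 n) φ.symm x v)
  exact h2.symm.trans (congrArg (fun w : RSpace n => coordField φ w (φ.symm x)) h1)

theorem contMDiff_const_field (v : RSpace n) :
    ContMDiff (𝓡 n) (𝓡 n).tangent ∞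
      (fun x => (⟨x, v⟩ : TangentBundle (𝓡 n) (RSpace n))) := fun _ =>
  contMDiffAt_vectorSpace_iff_contDiffAt.2 contDiffAt_const

include hφ in
theorem isSmoothFieldOn_coordField (v : RSpace n) :
    IsSmoothFieldOn (coordField φ v) φ.source := fun y hy =>
  (ContMDiffAt.mpullback_vectorField_preimage (m := ∞) (n := ∞)
    (contMDiff_const_field v (φ y))
    ((contMDiffOn_of_mem_maximalAtlas hφ).contMDiffAt (φ.open_source.mem_nhds hy))
    (isInvertible_mfderiv_chart hφ hy) (by simp)).contMDiffWithinAt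

-- Brackets of constant fields vanish in the model space and are natural under pullback. This
-- removes the bracket terms when the Lie derivative condition is evaluated on coordinate fields.
include hφ in
theorem mlieBracket_coordField {y : M} (hy : y ∈ φ.source) (v w : RSpace n) :
    VectorField.mlieBracket (𝓡 n) (coordField φ v) (coordField φ w) y = 0 := by
  have h2 : minSmoothness ℝ 2 ≤ (∞ : WithTop ℕ∞) := by
    rw [minSmoothness_of_isRCLikeNormedField]
    exact WithTop.coe_le_coe.2 le_top
  have : IsManifold (𝓡 n) (minSmoothness ℝ 2) M := IsManifold.of_le h2
  have h := VectorField.mpullback_mlieBracket (I := 𝓡 n) (I' := 𝓡 n) (n := ∞) (f := φ)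
    (V := fun _ => v) (W := fun _ => w) (x₀ := y)
    ((contMDiff_const_field v).mdifferentiable (by simp) _)
    ((contMDiff_const_field w).mdifferentiable (by simp) _)
    ((contMDiffOn_of_mem_maximalAtlas hφ).contMDiffAt (φ.open_source.mem_nhds hy)) h2
  refine h.symm.trans ?_
  have h0 : VectorField.mlieBracket (𝓡 n) (M := RSpace n) (fun _ => v) (fun _ => w) = 0 := by
    funext x
    have h1 : VectorField.lieBracketWithin ℝ (fun _ : RSpace n => v) (fun _ => w) univ x = 0 := by
      simp [VectorField.lieBracket]
    exact (congrFun VectorField.mlieBracketWithin_univ x).symm.trans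
      ((congrFun VectorField.mlieBracketWithin_eq_lieBracketWithin x).trans h1)
  rw [h0, VectorField.mpullback_zero]
  rfl

end coordField

/-- The coefficients of the metric in the chart `φ`. -/
noncomputable def LorentzMetric.coeff (g : F.LorentzMetric)
    (φ : OpenPartialHomeomorph M (RSpace n)) (y : M) : RSpace n →L[ℝ] RSpace n →L[ℝ] ℝ :=
  have B : RSpace n →L[ℝ] RSpace n →L[ℝ] ℝ := g.val y
  have D : RSpace n →L[ℝ] RSpace n := (mfderiv (𝓡 n) (𝓡 n) φ y).inverse
  B.bilinearComp D D

namespace LorentzMetric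

variable {φ : OpenPartialHomeomorph M (RSpace n)} (g : F.LorentzMetric)

theorem coeff_apply (y : M) (v w : RSpace n) :
    g.coeff φ y v w = g.val y (coordField φ v y) (coordField φ w y) := rfl

variable (hφ : φ ∈ IsManifold.maximalAtlas (𝓡 n) ∞ M)

theorem contMDiffOn_val {O : Set M} {X Y : ∀ x : M, TangentSpace (𝓡 n) x}
    (hX : IsSmoothFieldOn X O) (hY : IsSmoothFieldOn Y O) :
    ContMDiffOn (𝓡 n) 𝓘(ℝ, ℝ) ∞ (fun y => g.val y (X y) (Y y)) O := by
  have h := ContMDiffOn.clm_bundle_apply₂ (F₁ := RSpace n) (F₂ := RSpace n) (F₃ := ℝ)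
    (E₃ := Bundle.Trivial M ℝ) (b := fun y : M => y) (ψ := g.val) g.contMDiff.contMDiffOn hX hY
  exact fun y hy => ((Bundle.contMDiffWithinAt_totalSpace).1 (h y hy)).2

include hφ in
theorem contMDiffOn_coeff (v w : RSpace n) :
    ContMDiffOn (𝓡 n) 𝓘(ℝ, ℝ) ∞ (fun y => g.coeff φ y v w) φ.source :=
  g.contMDiffOn_val (isSmoothFieldOn_coordField hφ v) (isSmoothFieldOn_coordField hφ w)

end LorentzMetric

end FoliationCocycle

/-! ### Submersion charts and invariance of the coefficients along fibres. -/

namespace FoliationCocycle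

variable {ι : Type*} {n q : ℕ} {M : Type*} [TopologicalSpace M]
  [ChartedSpace (RSpace n) M] [IsManifold (𝓡 n) ∞ M]
  {F : FoliationCocycle ι n q M}

/-- A chart around a point of `U i` in which `π i` is a linear map, up to a change of coordinates
of the target. -/
theorem exists_submersion_chart {i : ι} {p : M} (hp : p ∈ F.U i) :
    ∃ φ ∈ IsManifold.maximalAtlas (𝓡 n) ∞ M, p ∈ φ.source ∧
      ∃ (L : RSpace n →L[ℝ] RSpace q) (σ : RSpace q → RSpace q),
        (∀ y ∈ φ.source, MDifferentiableAt (𝓡 q) (𝓡 q) σ (L (φ y)) ∧ F.π i y = σ (L (φ y))) ∧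
        ∀ y ∈ φ.source, ∀ y' ∈ φ.source, F.π i y = F.π i y' → L (φ y) = L (φ y') := by
  have h := F.submersion i p hp
  have hw : ∀ y ∈ h.domChart.source, h.codChart (F.π i y) = (h.equiv (h.domChart y)).1 := by
    intro y hy
    have hyt : h.domChart y ∈ (h.domChart.extend (𝓡 n)).target := by
      simpa using h.domChart.map_source hy
    have := h.writtenInCharts hyt
    simpa [h.domChart.left_inv hy] using this
  refine ⟨h.domChart, h.domChart_mem_maximalAtlas, h.mem_domChart_source,
    (ContinuousLinearMap.fst ℝ _ _).comp (h.equiv : RSpace n →L[ℝ] RSpace q × h.complement),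
    h.codChart.symm, fun y hy => ?_, fun y hy y' hy' hπ => ?_⟩
  · have hs : F.π i y ∈ h.codChart.source := h.source_subset_preimage_source hy
    change MDifferentiableAt (𝓡 q) (𝓡 q) h.codChart.symm (h.equiv (h.domChart y)).1 ∧
      F.π i y = h.codChart.symm (h.equiv (h.domChart y)).1
    rw [← hw y hy, h.codChart.left_inv hs]
    exact ⟨((contMDiffOn_symm_of_mem_maximalAtlas h.codChart_mem_maximalAtlas).contMDiffAt
      (h.codChart.open_target.mem_nhds (h.codChart.map_source hs))).mdifferentiableAt (by simp), rfl⟩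
  · change (h.equiv (h.domChart y)).1 = (h.equiv (h.domChart y')).1
    rw [← hw y hy, ← hw y' hy', hπ]

section

variable {φ : OpenPartialHomeomorph M (RSpace n)}
  (hφ : φ ∈ IsManifold.maximalAtlas (𝓡 n) ∞ M)

include hφ in
theorem coordField_mem_tangent {i : ι} {L : RSpace n →L[ℝ] RSpace q} {σ : RSpace q → RSpace q}
    (h : ∀ y ∈ φ.source, MDifferentiableAt (𝓡 q) (𝓡 q) σ (L (φ y)) ∧ F.π i y = σ (L (φ y)))
    {k : RSpace n} (hk : L k = 0) {y : M} (hy : y ∈ φ.source) (hyi : y ∈ F.U i) :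
    coordField φ k y ∈ F.tangent y := by
  refine mem_tangent hyi ?_
  have hd := (mdifferentiable_of_mem_maximalAtlas hφ).mdifferentiableAt hy
  have h1 := ((h y hy).1.hasMFDerivAt.comp (φ y) (L.hasMFDerivAt)).comp y hd.hasMFDerivAt
  have heq : F.π i =ᶠ[𝓝 y] (σ ∘ L) ∘ φ := by
    filter_upwards [φ.open_source.mem_nhds hy] with z hz using (h z hz).2
  refine (DFunLike.congr_fun (h1.congr_of_eventuallyEq heq).mfderiv (coordField φ k y)).trans ?_
  have h2 : L (mfderiv (𝓡 n) (𝓡 n) φ y (coordField φ k y)) = 0 :=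
    (congrArg L (mfderiv_coordField hφ hy k)).trans hk
  exact (congrArg (mfderiv (𝓡 q) (𝓡 q) σ (L (φ y))) h2).trans (map_zero _)

namespace LorentzMetric

variable (g : F.LorentzMetric)

include hφ in
/-- The coefficients of the metric do not change along vertical coordinate directions. -/
theorem dirDeriv_coeff {k : RSpace n} {O : Set M} (hO : IsOpen O) (hOs : O ⊆ φ.source)
    (hk : ∀ y ∈ O, coordField φ k y ∈ F.tangent y) (v w : RSpace n) {y : M} (hy : y ∈ O) :
    dirDeriv (fun y => g.coeff φ y v w) y (coordField φ k y) = 0 := by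
  have h := g.lie_eq_zero O hO (coordField φ k) (coordField φ v) (coordField φ w)
    ((isSmoothFieldOn_coordField hφ k).mono hOs) ((isSmoothFieldOn_coordField hφ v).mono hOs)
    ((isSmoothFieldOn_coordField hφ w).mono hOs) hk y hy
  rw [mlieBracket_coordField hφ (hOs hy), mlieBracket_coordField hφ (hOs hy), map_zero,
    map_zero, zero_apply, sub_zero, sub_zero] at h
  exact h

-- Along the segment from `x` to `x + k` the coefficient has derivative zero by `dirDeriv_coeff`;
-- convexity of `B` keeps the segment where that applies.
include hφ in
theorem coeff_add_eq {k : RSpace n} {O : Set M} (hO : IsOpen O) (hOs : O ⊆ φ.source)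
    (hk : ∀ y ∈ O, coordField φ k y ∈ F.tangent y) (v w : RSpace n) {B : Set (RSpace n)}
    (hB : Convex ℝ B) (hBt : B ⊆ φ.target) (hBO : ∀ x ∈ B, φ.symm x ∈ O) {x : RSpace n}
    (hx : x ∈ B) (hxk : x + k ∈ B) :
    g.coeff φ (φ.symm (x + k)) v w = g.coeff φ (φ.symm x) v w := by
  have hmem : ∀ t ∈ Icc (0 : ℝ) 1, x + t • k ∈ B := fun t ht => by
    simpa using hB.add_smul_sub_mem hx hxk ht
  have hderiv : ∀ t ∈ Icc (0 : ℝ) 1,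
      HasDerivAt (fun s : ℝ => g.coeff φ (φ.symm (x + s • k)) v w) 0 t := fun t ht => by
    have hxt := hmem t ht
    have hl : ContMDiff 𝓘(ℝ, ℝ) (𝓡 n) ∞ (fun t : ℝ => x + t • k) :=
      ContDiff.contMDiff (by fun_prop)
    have hf : MDifferentiableAt (𝓡 n) 𝓘(ℝ, ℝ) (fun y => g.coeff φ y v w) (φ.symm (x + t • k)) :=
      ((g.contMDiffOn_coeff hφ v w).contMDiffAt
        (φ.open_source.mem_nhds (φ.map_target (hBt hxt)))).mdifferentiableAt (by simp)
    have h1 := (hf.hasMFDerivAt.comp (x + t • k)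
      ((mdifferentiable_of_mem_maximalAtlas hφ).mdifferentiableAt_symm (hBt hxt)).hasMFDerivAt).comp
      t (hl.mdifferentiable (by simp) t).hasMFDerivAt
    have h2 : (mfderiv 𝓘(ℝ, ℝ) (𝓡 n) (fun t : ℝ => x + t • k) t) (1 : ℝ) = k := by
      rw [mfderiv_eq_fderiv]
      have : HasDerivAt (fun t : ℝ => x + t • k) k t := by
        simpa using ((hasDerivAt_id t).smul_const k).const_add x
      have h3 := this.deriv
      rw [← fderiv_apply_one_eq_deriv] at h3
      exact h3
    have h4 : ∀ D : ℝ →L[ℝ] ℝ, HasMFDerivAt 𝓘(ℝ, ℝ) 𝓘(ℝ, ℝ)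
        (fun s : ℝ => g.coeff φ (φ.symm (x + s • k)) v w) t D → D 1 = 0 →
        HasDerivAt (fun s : ℝ => g.coeff φ (φ.symm (x + s • k)) v w) 0 t := fun D hD hD0 => by
      have h5 : HasFDerivAt (fun s : ℝ => g.coeff φ (φ.symm (x + s • k)) v w) D t :=
        hasMFDerivAt_iff_hasFDerivAt.1 hD
      rw [← hD0]
      exact h5.hasDerivAt
    refine h4 _ h1 ?_
    have h6 : mfderiv (𝓡 n) (𝓡 n) φ.symm (x + t • k)
        (mfderiv 𝓘(ℝ, ℝ) (𝓡 n) (fun t : ℝ => x + t • k) t (1 : ℝ)) =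
        coordField φ k (φ.symm (x + t • k)) :=
      (congrArg (mfderiv (𝓡 n) (𝓡 n) φ.symm (x + t • k)) h2).trans
        (mfderiv_symm_eq_coordField hφ (hBt hxt) k)
    exact (congrArg (mfderiv (𝓡 n) 𝓘(ℝ, ℝ) (fun y => g.coeff φ y v w) (φ.symm (x + t • k)))
      h6).trans (g.dirDeriv_coeff hφ hO hOs hk v w (hBO _ hxt))
  have h := constant_of_has_deriv_right_zero (a := 0) (b := 1)
    (fun t ht => (hderiv t ht).continuousAt.continuousWithinAt)
    (fun t ht => (hderiv t (Ico_subset_Icc_self ht)).hasDerivWithinAt) 1 (by simp)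
  simpa using h

theorem coeff_vertical {k : RSpace n} {y : M} (hk : coordField φ k y ∈ F.tangent y)
    (w : RSpace n) : g.coeff φ y k w = 0 :=
  (g.radical y _).2 hk _

theorem coeff_symm (y : M) (v w : RSpace n) : g.coeff φ y v w = g.coeff φ y w v :=
  g.symm y _ _

/-- The timewedges are half-cones. -/
theorem timewedge_eq {x : M} {W : Set (TangentSpace (𝓡 n) x)} (hW : g.IsTimewedge x W)
    {u : TangentSpace (𝓡 n) x} (hu : u ∈ W) :
    W = {v | g.val x v v < 0 ∧ g.val x v u < 0} := by
  obtain ⟨u₀, -, rfl⟩ := hW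
  have hut : g.val x u u < 0 := connectedComponentIn_subset (g.timelike x) u₀ hu
  rw [connectedComponentIn_eq hu]
  have : FiniteDimensional ℝ (TangentSpace (𝓡 n) x) :=
    inferInstanceAs (FiniteDimensional ℝ (RSpace n))
  exact connectedComponentIn_timelike (g.val x) (g.symm x) (g.index_eq_one x) hut

end LorentzMetric

end

end FoliationCocycle

/-! ### The future timewedges form a basic cone field. -/

namespace FoliationCocycle

variable {ι : Type*} {n q : ℕ} {M : Type*} [TopologicalSpace M]
  [ChartedSpace (RSpace n) M] [IsManifold (𝓡 n) ∞ M]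
  {F : FoliationCocycle ι n q M}

namespace LorentzMetric

variable {φ : OpenPartialHomeomorph M (RSpace n)}
  (hφ : φ ∈ IsManifold.maximalAtlas (𝓡 n) ∞ M)

theorem coeff_mfderiv (g : F.LorentzMetric) (hφ : φ ∈ IsManifold.maximalAtlas (𝓡 n) ∞ M)
    {y : M} (hy : y ∈ φ.source) {e : TangentSpace (𝓡 n) y} {a : RSpace n}
    (ha : mfderiv (𝓡 n) (𝓡 n) φ y e = a) (b : RSpace n) :
    g.coeff φ y a b = g.val y e (coordField φ b y) := by
  rw [coeff_apply, ← ha, coordField_mfderiv hφ hy]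

theorem continuousOn_coeff (g : F.LorentzMetric)
    (hφ : φ ∈ IsManifold.maximalAtlas (𝓡 n) ∞ M) :
    ContinuousOn (fun x => g.coeff φ (φ.symm x)) φ.target := by
  refine continuousOn_clm_apply.2 fun v => continuousOn_clm_apply.2 fun w => ?_
  exact (g.contMDiffOn_coeff hφ v w).continuousOn.comp φ.continuousOn_symm φ.mapsTo_symm

namespace TimeOrientation

variable {g : F.LorentzMetric} (T : g.TimeOrientation)

include hφ in
/-- Near `p`, the future timewedges are determined by a constant vector of a chart. -/
theorem exists_future_iff {p : M} (hp : p ∈ φ.source) :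
    ∃ v₀ : RSpace n, ∀ᶠ y in 𝓝 p, g.coeff φ y v₀ v₀ < 0 ∧
      ∀ v : TangentSpace (𝓡 n) y,
        v ∈ T.future y ↔ g.val y v v < 0 ∧ g.val y v (coordField φ v₀ y) < 0 := by
  obtain ⟨O, hO, hpO, X, hX, hXf⟩ := T.smooth p
  have hXp : coordField φ (mfderiv (𝓡 n) (𝓡 n) φ p (X p)) p = X p := coordField_mfderiv hφ hp _
  -- The local future field `X` is frozen at `p`. By continuity the constant field `v₀` stays
  -- timelike, and in the same wedge as `X`, near `p`.
  set v₀ : RSpace n := mfderiv (𝓡 n) (𝓡 n) φ p (X p)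
  have hpp : g.val p (X p) (X p) < 0 := by
    have h := hXf p hpO
    rw [g.timewedge_eq (T.isTimewedge p) h] at h
    exact h.1
  have h1 : ∀ᶠ y in 𝓝 p, g.coeff φ y v₀ v₀ < 0 := by
    refine (((g.contMDiffOn_coeff hφ v₀ v₀).continuousOn.continuousAt
      (φ.open_source.mem_nhds hp)).tendsto).eventually_lt_const ?_
    rwa [coeff_apply, hXp]
  have h2 : ∀ᶠ y in 𝓝 p, g.val y (coordField φ v₀ y) (X y) < 0 := by
    have hc := (g.contMDiffOn_val
      ((isSmoothFieldOn_coordField hφ v₀).mono (inter_subset_left (t := O)))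
      (hX.mono (inter_subset_right (s := φ.source)))).continuousOn.continuousAt
      ((φ.open_source.inter hO).mem_nhds ⟨hp, hpO⟩)
    refine hc.tendsto.eventually_lt_const ?_
    rwa [hXp]
  refine ⟨v₀, ?_⟩
  filter_upwards [h1, h2, hO.mem_nhds hpO] with y h1 h2 hyO
  refine ⟨h1, fun v => ?_⟩
  have hu : coordField φ v₀ y ∈ T.future y := by
    rw [g.timewedge_eq (T.isTimewedge y) (hXf y hyO)]
    exact ⟨h1, h2⟩
  rw [g.timewedge_eq (T.isTimewedge y) hu]
  rfl

/-- In a submersion chart the wedges are given by `g (v, v) < 0` and `g (v, v₀) < 0`. Both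
conditions are open by continuity of the coefficients. They are unchanged by vertical translations
of the base point (`coeff_add_eq`) and of the vector (`coeff_vertical`). -/
theorem isBasicConeField : IsBasicConeField F T.future := by
  intro i p hp O hO
  obtain ⟨φ, hφ, hpφ, L, σ, hσ, hL⟩ := exists_submersion_chart hp
  obtain ⟨v₀, hv₀⟩ := T.exists_future_iff hφ hpφ
  have hnear : ∀ᶠ x in 𝓝 (φ p), x ∈ φ.target ∧ φ.symm x ∈ F.U i ∧ φ.symm x ∈ O ∧
      g.coeff φ (φ.symm x) v₀ v₀ < 0 ∧ ∀ v : TangentSpace (𝓡 n) (φ.symm x),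
        v ∈ T.future (φ.symm x) ↔
          g.val (φ.symm x) v v < 0 ∧ g.val (φ.symm x) v (coordField φ v₀ (φ.symm x)) < 0 := by
    have ht : Filter.Tendsto φ.symm (𝓝 (φ p)) (𝓝 p) := by
      have := φ.continuousAt_symm (φ.map_source hpφ)
      rwa [ContinuousAt, φ.left_inv hpφ] at this
    filter_upwards [φ.open_target.mem_nhds (φ.map_source hpφ),
      ht.eventually ((F.isOpen_U i).mem_nhds hp), ht.eventually hO, ht.eventually hv₀]
      with x h1 h2 h3 h4 using ⟨h1, h2, h3, h4⟩
  obtain ⟨r, hr, hball⟩ := Metric.eventually_nhds_iff_ball.1 hnear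
  set B := Metric.ball (φ p) r
  have hBt : B ⊆ φ.target := fun x hx => (hball x hx).1
  have hO' : IsOpen (φ.source ∩ F.U i) := φ.open_source.inter (F.isOpen_U i)
  have hBO : ∀ x ∈ B, φ.symm x ∈ φ.source ∩ F.U i := fun x hx =>
    ⟨φ.map_target (hBt hx), (hball x hx).2.1⟩
  have hvert : ∀ k ∈ LinearMap.ker (L : RSpace n →ₗ[ℝ] RSpace q), ∀ y ∈ φ.source ∩ F.U i,
      coordField φ k y ∈ F.tangent y := fun k hk y hy =>
    coordField_mem_tangent hφ hσ (LinearMap.mem_ker.1 hk) hy.1 hy.2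
  have htarget : φ.target ∩ B = B := inter_eq_right.2 hBt
  -- Restricting on the side of the target makes the target the ball `B`, hence convex.
  let ψ : OpenPartialHomeomorph M (RSpace n) := (φ.symm.restrOpen B Metric.isOpen_ball).symm
  have hψs : ψ.source = φ.source ∩ φ ⁻¹' B := rfl
  have hψt : ψ.target = B := htarget
  refine ⟨{
    φ := ψ
    smooth := (contMDiffOn_of_mem_maximalAtlas hφ).mono inter_subset_left
    smooth_symm := (contMDiffOn_symm_of_mem_maximalAtlas hφ).mono inter_subset_left
    convex := by rw [hψt]; exact convex_ball _ _
    K := LinearMap.ker (L : RSpace n →ₗ[ℝ] RSpace q)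
    sub_mem := fun y hy y' hy' hπ => ?_
    C := {z | z.1 ∈ B ∧ g.coeff φ (φ.symm z.1) z.2 z.2 < 0 ∧
      g.coeff φ (φ.symm z.1) z.2 v₀ < 0}
    isOpen_C := ?_
    mem_cone := fun y hy v => ?_
    add_mem := fun x v k k' h _ hxk hk hk' => ?_
    smul_mem := fun x v c hc _ h => ?_
    ne_zero := fun x v _ h => ?_
    nonempty := fun x hx => ?_ }, ⟨hpφ, Metric.mem_ball_self hr⟩, fun y hy => ?_⟩
  · rw [LinearMap.mem_ker, map_sub, sub_eq_zero]
    exact hL y hy.1 y' hy'.1 hπ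
  · have hc : ContinuousOn (fun z : RSpace n × RSpace n => g.coeff φ (φ.symm z.1) z.2)
        (B ×ˢ univ) :=
      (((g.continuousOn_coeff hφ).mono hBt).comp continuousOn_fst fun z hz => hz.1).clm_apply
        continuousOn_snd
    have ho : IsOpen (B ×ˢ (univ : Set (RSpace n))) := Metric.isOpen_ball.prod isOpen_univ
    have h1 := (hc.clm_apply continuousOn_snd).isOpen_inter_preimage ho (isOpen_Iio (a := 0))
    have h2 := (hc.clm_apply (continuousOn_const (c := v₀))).isOpen_inter_preimage ho
      (isOpen_Iio (a := 0))
    convert h1.inter h2 using 1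
    ext z
    simp only [mem_inter_iff, mem_prod, mem_univ, and_true, mem_preimage, mem_Iio]
    constructor
    · rintro ⟨h1, h2, h3⟩
      exact ⟨⟨h1, h2⟩, h1, h3⟩
    · rintro ⟨⟨h1, h2⟩, -, h3⟩
      exact ⟨h1, h2, h3⟩
  · have h := (hball _ hy.2).2.2.2.2
    have hinv : φ.symm (φ y) = y := φ.left_inv hy.1
    change ∀ v : TangentSpace (𝓡 n) (φ.symm (φ y)), v ∈ T.future (φ.symm (φ y)) ↔
      g.val (φ.symm (φ y)) v v < 0 ∧
        g.val (φ.symm (φ y)) v (coordField φ v₀ (φ.symm (φ y))) < 0 at h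
    rw [hinv] at h
    have key : ∀ a : RSpace n, mfderiv (𝓡 n) (𝓡 n) φ y v = a → (v ∈ T.future y ↔ φ y ∈ B ∧
        g.coeff φ (φ.symm (φ y)) a a < 0 ∧ g.coeff φ (φ.symm (φ y)) a v₀ < 0) := fun a ha => by
      have hav : coordField φ a y = v := by rw [← ha, coordField_mfderiv hφ hy.1]
      rw [hinv, h, coeff_mfderiv g hφ hy.1 ha, coeff_mfderiv g hφ hy.1 ha, hav]
      exact (and_iff_right hy.2).symm
    exact key _ rfl
  · rw [hψt] at hxk
    have hx := h.1
    have hvk : ∀ w, g.coeff φ (φ.symm x) k' w = 0 := fun w =>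
      g.coeff_vertical (hvert k' hk' _ (hBO x hx)) w
    have heq : ∀ v w, g.coeff φ (φ.symm (x + k)) v w = g.coeff φ (φ.symm x) v w := fun v w =>
      g.coeff_add_eq hφ hO' inter_subset_left (hvert k hk) v w (convex_ball _ _) hBt hBO hx hxk
    refine ⟨hxk, ?_⟩
    simp only [heq, map_add, add_apply, hvk, g.coeff_symm _ v k', add_zero]
    exact h.2
  · refine ⟨h.1, ?_, ?_⟩
    · simp only [map_smul, smul_apply, smul_eq_mul]
      exact mul_neg_of_pos_of_neg hc (mul_neg_of_pos_of_neg hc h.2.1)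
    · simp only [map_smul, smul_apply, smul_eq_mul]
      exact mul_neg_of_pos_of_neg hc h.2.2
  · rintro rfl
    have := h.2.1
    simp at this
  · rw [hψt] at hx
    exact ⟨v₀, hx, (hball x hx).2.2.2.1, (hball x hx).2.2.2.1⟩
  · rw [← φ.left_inv hy.1]
    exact (hball _ hy.2).2.2.1

end TimeOrientation

end LorentzMetric

end FoliationCocycle

/-! ### Timelike curves as chains of pieces; the transverse closure. -/

namespace FoliationCocycle

variable {ι : Type*} {n q : ℕ} {M : Type*} [TopologicalSpace M]
  [ChartedSpace (RSpace n) M] [IsManifold (𝓡 n) ∞ M]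
  {F : FoliationCocycle ι n q M} {Fut : ∀ x : M, Set (TangentSpace (𝓡 n) x)}

theorem IsPiece.congr {α β : ℝ → M} {a b : ℝ} (h : IsPiece Fut α a b)
    (hβ : EqOn β α (Icc a b)) : IsPiece Fut β a b := by
  refine ⟨h.1, h.2.1.congr hβ, fun s hs => ?_⟩
  rw [mfderivWithin_congr hβ (hβ hs), hβ hs]
  exact h.2.2 s hs

theorem IsPiece.shift {α : ℝ → M} {a b : ℝ} (h : IsPiece Fut α a b) (c : ℝ) :
    IsPiece Fut (fun r => α (1 * r + (a - c))) c (c + (b - a)) := by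
  have hab : c < c + (b - a) := by linarith [h.1]
  have hm : MapsTo (fun r : ℝ => 1 * r + (a - c)) (Icc c (c + (b - a))) (Icc a b) := by
    rintro r ⟨h1, h2⟩
    constructor <;> simp only [one_mul] <;> linarith
  have hl : ContMDiff 𝓘(ℝ, ℝ) 𝓘(ℝ, ℝ) ∞ (fun r : ℝ => 1 * r + (a - c)) :=
    ContDiff.contMDiff (by fun_prop)
  refine ⟨hab, h.2.1.comp hl.contMDiffOn hm, fun s hs => ?_⟩
  rw [mfderivWithin_comp_affine (h.2.1.mdifferentiableOn (by simp) _ (hm hs)) hm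
    ((uniqueDiffOn_Icc hab).uniqueMDiffOn s hs), one_smul]
  exact h.2.2 _ (hm hs)

namespace LorentzMetric.TimeOrientation

variable {g : F.LorentzMetric} {T : g.TimeOrientation}

theorem isTimelikeCurve_of_isPiece {α : ℝ → M} {a b : ℝ} (h : IsPiece T.future α a b) :
    T.IsTimelikeCurve α a b := by
  refine ⟨h.1, 1, fun i => if i = 0 then a else b, by simp, by simp, fun i hi => ?_⟩
  obtain rfl : i = 0 := by omega
  change IsPiece T.future _ _ _
  simpa using h

theorem IsTimelikeCurve.continuousOn_and_reach {α : ℝ → M} {a b : ℝ}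
    (h : T.IsTimelikeCurve α a b) : ContinuousOn α (Icc a b) ∧ Reach T.future (α a) (α b) := by
  obtain ⟨hab, k, t, rfl, rfl, ht⟩ := h
  have hp : ∀ i < k, IsPiece T.future α (t i) (t (i + 1)) := ht
  have key : ∀ j < k, t 0 ≤ t j ∧ ContinuousOn α (Icc (t 0) (t (j + 1))) ∧
      Reach T.future (α (t 0)) (α (t (j + 1))) := by
    intro j
    induction j with
    | zero =>
      intro hj
      exact ⟨le_rfl, (hp 0 hj).2.1.continuousOn, .single ⟨α, _, _, hp 0 hj, rfl, rfl⟩⟩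
    | succ j ih =>
      intro hj
      obtain ⟨h1, h2, h3⟩ := ih (by omega)
      have h4 := (hp j (by omega)).1.le
      refine ⟨h1.trans h4, ?_, h3.tail ⟨α, _, _, hp _ hj, rfl, rfl⟩⟩
      rw [← Icc_union_Icc_eq_Icc (h1.trans h4) (hp _ hj).1.le]
      exact h2.union_of_isClosed (hp _ hj).2.1.continuousOn isClosed_Icc isClosed_Icc
  -- An empty subdivision would give `a = b`.
  obtain _ | k := k
  · exact absurd hab (lt_irrefl _)
  · exact (key k (Nat.lt_succ_self k)).2

theorem exists_isTimelikeCurve_of_reach {x y : M} (h : Reach T.future x y) :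
    ∃ α a b, T.IsTimelikeCurve α a b ∧ α a = x ∧ α b = y := by
  induction h with
  | single h =>
    obtain ⟨α, a, b, h, rfl, rfl⟩ := h
    exact ⟨α, a, b, isTimelikeCurve_of_isPiece h, rfl, rfl⟩
  | tail _ h ih =>
    obtain ⟨α, a, b, ⟨hab, k, t, rfl, rfl, ht⟩, hα, hαb⟩ := ih
    obtain ⟨β, c, d, hβ, hβc, rfl⟩ := h
    have hp : ∀ i < k, IsPiece T.future α (t i) (t (i + 1)) := ht
    have hmono : ∀ i ≤ k, t i ≤ t k := fun i hi => by
      induction hi using Nat.decreasingInduction with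
      | self => exact le_rfl
      | of_succ j hj ih => exact (hp j hj).1.le.trans ih
    -- The new piece is reparametrised to start at time `t k`, where it agrees with `α`.
    have hs := hβ.shift (t k)
    have hcd : t k < t k + (d - c) := hs.1
    refine ⟨fun s => if s ≤ t k then α s else β (1 * s + (c - t k)), t 0, t k + (d - c),
      ⟨hab.trans hcd, k + 1, fun i => if i ≤ k then t i else t k + (d - c), by simp, by simp,
        fun i hi => ?_⟩, by simp [hab.le, hα], ?_⟩
    · change IsPiece T.future _ _ _
      obtain hik | rfl := (Nat.lt_succ_iff.1 hi).lt_or_eq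
      · simp only [hik.le, Nat.succ_le_of_lt hik, if_true]
        refine (hp i hik).congr fun s hs => ?_
        simp [hs.2.trans (hmono _ hik)]
      · simp only [le_refl, if_true, Nat.not_succ_le_self, if_false]
        refine hs.congr fun s hs => ?_
        obtain h | h := hs.1.eq_or_lt
        · subst h
          simp [hαb, hβc]
        · simp [h.not_ge]
    · simp only [hcd.not_ge, if_false]
      congr 1
      ring

theorem isAchronal_iff {A : Set M} :
    T.IsAchronal A ↔ ∀ x ∈ A, ∀ y ∈ A, ¬ Reach T.future x y := by
  constructor
  · intro h x hx y hy hr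
    obtain ⟨α, a, b, hα, rfl, rfl⟩ := exists_isTimelikeCurve_of_reach hr
    exact h ⟨α, a, b, hα, hx, hy⟩
  · rintro h ⟨α, a, b, hα, ha, hb⟩
    exact h _ ha _ hb hα.continuousOn_and_reach.2

/-- A curve between the leaves need not start at `x` or end at `y`; leaf invariance of `Reach` moves
its ends there. -/
theorem chron_univ_iff {x y : M} :
    T.Chron univ (F.leaf x) (F.leaf y) ↔ Reach T.future x y := by
  constructor
  · rintro ⟨α, a, b, hα, -, ha, hb⟩
    rw [← T.isBasicConeField.reach_congr_left ha, ← T.isBasicConeField.reach_congr_right hb]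
    exact hα.continuousOn_and_reach.2
  · intro h
    obtain ⟨α, a, b, hα, rfl, rfl⟩ := exists_isTimelikeCurve_of_reach h
    exact ⟨α, a, b, hα, fun _ _ => mem_univ _, rfl, rfl⟩

theorem chronFuture_univ (A : Set M) :
    T.chronFuture univ A = {y | ∃ x ∈ A, Reach T.future x y} := by
  ext y
  simp [chronFuture, chron_univ_iff]

theorem chronPast_univ (A : Set M) :
    T.chronPast univ A = {y | ∃ x ∈ A, Reach T.future y x} := by
  ext y
  simp [chronPast, chron_univ_iff]

theorem mem_chronFuture_leaf {W : Set M} {x y : M} (h : T.Chron W (F.leaf x) (F.leaf y)) :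
    y ∈ T.chronFuture W (F.leaf ⁻¹' {F.leaf x}) :=
  ⟨F.leaf x, ⟨x, rfl, rfl⟩, h⟩

theorem mem_chronPast_leaf {W : Set M} {x y : M} (h : T.Chron W (F.leaf y) (F.leaf x)) :
    y ∈ T.chronPast W (F.leaf ⁻¹' {F.leaf x}) :=
  ⟨F.leaf x, ⟨x, rfl, rfl⟩, h⟩

end LorentzMetric.TimeOrientation

theorem inter_nonempty_of_mem_transverseClosure {A O : Set M} {x : M}
    (hx : x ∈ F.transverseClosure A) (hO : IsOpen O)
    (hs : ∀ x ∈ O, ∀ y, F.leaf x = F.leaf y → y ∈ O) (hxO : x ∈ O) : (O ∩ A).Nonempty :=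
  (@mem_closure_iff M F.saturatedTopology x A).1 hx O ⟨hO, (F.isSaturated_iff O).2 hs⟩ hxO

theorem subset_transverseClosure (A : Set M) : A ⊆ F.transverseClosure A :=
  @subset_closure M F.saturatedTopology A

theorem isSaturated_of_isTransverselyClosed {A : Set M} (h : F.IsTransverselyClosed A) :
    F.IsSaturated A := by
  have hc : @IsClosed M F.saturatedTopology A := by
    rw [← h]
    exact @isClosed_closure M F.saturatedTopology A
  have ho := (F.isSaturated_iff Aᶜ).1 (@IsClosed.isOpen_compl M F.saturatedTopology A hc).2
  rw [isSaturated_iff]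
  intro x hx y hxy
  by_contra hy
  exact ho y hy x hxy.symm hx

/-! ### Consequences of openness, transitivity and leaf invariance. -/

/-- A transitive relation which is open and compatible with the leaves. -/
structure IsOpenLeafRelation (F : FoliationCocycle ι n q M) (R : M → M → Prop) : Prop where
  trans : ∀ {x y z}, R x y → R y z → R x z
  isOpen_from : ∀ x, IsOpen {y | R x y}
  isOpen_to : ∀ y, IsOpen {x | R x y}
  congr_left : ∀ {x x'}, F.leaf x = F.leaf x' → ∀ y, R x y → R x' y
  congr_right : ∀ {y y'}, F.leaf y = F.leaf y' → ∀ x, R x y → R x y'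

namespace IsOpenLeafRelation

variable {R : M → M → Prop}

theorem swap (h : IsOpenLeafRelation F R) : IsOpenLeafRelation F (fun x y => R y x) :=
  ⟨fun h1 h2 => h.trans h2 h1, h.isOpen_to, h.isOpen_from, h.congr_right, h.congr_left⟩

theorem isOpen_image (h : IsOpenLeafRelation F R) (A : Set M) : IsOpen {y | ∃ x ∈ A, R x y} := by
  have : {y | ∃ x ∈ A, R x y} = ⋃ x ∈ A, {y | R x y} := by
    ext y
    simp
  rw [this]
  exact isOpen_biUnion fun x _ => h.isOpen_from x

/-- If `R x y`, the past of `y` is a neighbourhood of `x` and so meets the future set. By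
transitivity `y` lies in that set, which is open and hence disjoint from its frontier. -/
theorem not_rel_of_mem_frontier (h : IsOpenLeafRelation F R) {A : Set M} {x y : M}
    (hx : x ∈ frontier {y | ∃ x ∈ A, R x y}) (hy : y ∈ frontier {y | ∃ x ∈ A, R x y}) :
    ¬ R x y := by
  intro hxy
  obtain ⟨z, hz, w, hw, hwz⟩ := mem_closure_iff.1 (frontier_subset_closure hx) _ (h.isOpen_to y) hxy
  rw [(h.isOpen_image A).frontier_eq] at hy
  exact hy.2 ⟨w, hw, h.trans hwz hz⟩

/-- Pasts and futures of points are saturated and open, so in a related pair first `x` and then `y`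
can be replaced by a point of `A`. -/
theorem not_rel_of_mem_transverseClosure (h : IsOpenLeafRelation F R) {A : Set M}
    (hA : ∀ x ∈ A, ∀ y ∈ A, ¬ R x y) {x y : M} (hx : x ∈ F.transverseClosure A)
    (hy : y ∈ F.transverseClosure A) : ¬ R x y := by
  intro hxy
  obtain ⟨x', hx'y, hx'⟩ := inter_nonempty_of_mem_transverseClosure hx (h.isOpen_to y)
    (fun z hz w hzw => h.congr_left hzw y hz) hxy
  obtain ⟨y', hxy', hy'⟩ := inter_nonempty_of_mem_transverseClosure hy (h.isOpen_from x')
    (fun z hz w hzw => h.congr_right hzw x' hz) hx'y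
  exact hA x' hx' y' hy' hxy'

/-- A connected set reaching from the past to the future of a point of the transverse closure of
the frontier of a future set meets that frontier. -/
theorem inter_frontier_nonempty (h : IsOpenLeafRelation F R) {A S : Set M} {x u w : M}
    (hx : x ∈ F.transverseClosure (frontier {y | ∃ x ∈ A, R x y})) (hS : IsPreconnected S)
    (hu : u ∈ S) (hw : w ∈ S) (hux : R u x) (hxw : R x w) :
    (S ∩ frontier {y | ∃ x ∈ A, R x y}).Nonempty := by
  have hopen := h.isOpen_image A
  have hsat : ∀ x ∈ {y | ∃ x ∈ A, R x y}, ∀ y, F.leaf x = F.leaf y → y ∈ {y | ∃ x ∈ A, R x y} := by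
    rintro x ⟨a, ha, hax⟩ y hxy
    exact ⟨a, ha, h.congr_right hxy a hax⟩
  have hwI : w ∈ {y | ∃ x ∈ A, R x y} := by
    obtain ⟨z, hzw, hz⟩ := inter_nonempty_of_mem_transverseClosure hx (h.isOpen_to w)
      (fun z hz w' hzw => h.congr_left hzw w hz) hxw
    obtain ⟨z', hz', a, ha, haz⟩ :=
      mem_closure_iff.1 (frontier_subset_closure hz) _ (h.isOpen_to w) hzw
    exact ⟨a, ha, h.trans haz hz'⟩
  -- Otherwise `x` would lie in the future set, a saturated open set disjoint from its frontier,
  -- against the choice of `x`.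
  have huI : u ∉ {y | ∃ x ∈ A, R x y} := by
    rintro ⟨a, ha, hau⟩
    obtain ⟨z, hz, hzf⟩ := inter_nonempty_of_mem_transverseClosure hx hopen hsat
      ⟨a, ha, h.trans hau hux⟩
    rw [hopen.frontier_eq] at hzf
    exact hzf.2 hz
  rw [hopen.frontier_eq]
  by_contra hne
  have hcl : ∀ z ∈ S, z ∈ closure {y | ∃ x ∈ A, R x y} → z ∈ {y | ∃ x ∈ A, R x y} :=
    fun z hz hzc => by_contra fun hzI => hne ⟨z, hz, hzc, hzI⟩
  -- If `S` missed the frontier, the future set and the complement of its closure would disconnect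
  -- it.
  obtain ⟨z, -, hz1, hz2⟩ := hS _ (closure {y | ∃ x ∈ A, R x y})ᶜ hopen
    isClosed_closure.isOpen_compl
    (fun z hz => (em (z ∈ closure {y | ∃ x ∈ A, R x y})).imp (hcl z hz) id)
    ⟨w, hw, hwI⟩ ⟨u, hu, fun huc => huI (hcl u hu huc)⟩
  exact hz2 (subset_closure hz1)

end IsOpenLeafRelation

theorem IsBasicConeField.isOpenLeafRelation (h : IsBasicConeField F Fut) :
    IsOpenLeafRelation F (Reach Fut) where
  trans := Relation.TransGen.trans
  isOpen_from := h.isOpen_reach_from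
  isOpen_to := h.isOpen_reach_to
  congr_left hx y := (h.reach_congr_left hx y).1
  congr_right hy x := (h.reach_congr_right hy x).1

end FoliationCocycle

/-! ### Flattening a Lipschitz graph by a shear. -/

/-- The shear `x ↦ x - f x • v` along `v`, for a function `f` which is invariant under translations
by multiples of `v`, as a partial homeomorphism. -/
noncomputable def shearPartialHomeomorph {E : Type*} [NormedAddCommGroup E] [NormedSpace ℝ E]
    (v : E) (f : E → ℝ) (D O : Set E) (hD : IsOpen D) (hO : IsOpen O)
    (hDv : ∀ x ∈ D, ∀ s : ℝ, x + s • v ∈ D) (hf : ∀ x ∈ D, ∀ s : ℝ, f (x + s • v) = f x)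
    (hfc : ContinuousOn f D) : OpenPartialHomeomorph E E where
  toFun x := x + (-f x) • v
  invFun x := x + f x • v
  source := D ∩ O
  target := D ∩ (fun x => x + f x • v) ⁻¹' O
  map_source' x hx := by
    refine ⟨hDv x hx.1 _, ?_⟩
    rw [mem_preimage, hf x hx.1, add_assoc, ← add_smul, neg_add_cancel, zero_smul, add_zero]
    exact hx.2
  map_target' x hx := ⟨hDv x hx.1 _, hx.2⟩
  left_inv' x hx := by
    rw [hf x hx.1, add_assoc, ← add_smul, neg_add_cancel, zero_smul, add_zero]
  right_inv' x hx := by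
    rw [hf x hx.1, add_assoc, ← add_smul, add_neg_cancel, zero_smul, add_zero]
  open_source := hD.inter hO
  open_target := (continuousOn_id.add (hfc.smul continuousOn_const)).isOpen_inter_preimage hD hO
  continuousOn_toFun := (continuousOn_id.add (hfc.neg.smul continuousOn_const)).mono
    inter_subset_left
  continuousOn_invFun := (continuousOn_id.add (hfc.smul continuousOn_const)).mono
    inter_subset_left

/-- A set which meets each segment `y + [-δ, δ] v`, `y` near `x₀`, and does so in a Lipschitz way, is
a graph over a hyperplane near `x₀`. -/
theorem exists_graph_chart {E : Type*} [NormedAddCommGroup E] [NormedSpace ℝ E] {S : Set E}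
    {x₀ v : E} {r δ ρ : ℝ} (hr : 0 < r) (hδ : 0 < δ) (hρ : 0 < ρ) {ℓ : E →L[ℝ] ℝ} (hℓ : ℓ v = 1)
    (hex : ∀ y ∈ Metric.ball x₀ ρ, ∃ t ∈ Icc (-δ) δ, y + t • v ∈ S)
    (key : ∀ y ∈ Metric.ball x₀ ρ, ∀ z ∈ Metric.ball x₀ ρ, ∀ s ∈ Icc (-δ) δ, ∀ t ∈ Icc (-δ) δ,
      y + s • v ∈ S → z + t • v ∈ S → (t - s) * r ≤ ‖z - y‖) :
    ∃ e : OpenPartialHomeomorph E E, x₀ ∈ e.source ∧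
      ∀ x ∈ e.source, (x ∈ S ↔ ℓ (e x) = ℓ x₀) := by
  -- Projection along `v` onto the hyperplane through `x₀` parallel to the kernel of `ℓ`; `ℓ (x -
  -- x₀)` is the height above it.
  obtain ⟨h, hh⟩ : ∃ h : E → E, ∀ x, h x = x - ℓ (x - x₀) • v := ⟨_, fun _ => rfl⟩
  have hcont : Continuous h := by
    rw [funext hh]
    fun_prop
  have hhv : ∀ x (s : ℝ), h (x + s • v) = h x := fun x s => by
    simp only [hh, map_sub, map_add, map_smul, hℓ, smul_eq_mul, mul_one]
    module
  have hxh : ∀ x, h x + ℓ (x - x₀) • v = x := fun x => by rw [hh, sub_add_cancel]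
  have hle : ∀ y ∈ Metric.ball x₀ ρ, ∀ s ∈ Icc (-δ) δ, ∀ t ∈ Icc (-δ) δ,
      y + s • v ∈ S → y + t • v ∈ S → t ≤ s := by
    intro y hy s hs t ht hsA htA
    have := key y hy y hy s hs t ht hsA htA
    rw [sub_self, norm_zero] at this
    exact sub_nonpos.1 (nonpos_of_mul_nonpos_left this hr)
  have huniq : ∀ y ∈ Metric.ball x₀ ρ, ∀ s ∈ Icc (-δ) δ, ∀ t ∈ Icc (-δ) δ,
      y + s • v ∈ S → y + t • v ∈ S → s = t := fun y hy s hs t ht hsA htA =>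
    le_antisymm (hle y hy t ht s hs htA hsA) (hle y hy s hs t ht hsA htA)
  choose! f₀ hfI hfA using hex
  have hfc : ContinuousOn (f₀ ∘ h) (h ⁻¹' Metric.ball x₀ ρ) := by
    refine ContinuousOn.comp (t := Metric.ball x₀ ρ) (fun x hx => ?_) hcont.continuousOn
      (mapsTo_preimage _ _)
    rw [ContinuousWithinAt, tendsto_iff_dist_tendsto_zero]
    have hlim : Filter.Tendsto (fun y => ‖y - x‖ / r) (𝓝[Metric.ball x₀ ρ] x) (𝓝 0) := by
      have : ContinuousAt (fun y => ‖y - x‖ / r) x := by fun_prop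
      simpa [ContinuousAt] using
        this.tendsto.mono_left (nhdsWithin_le_nhds (s := Metric.ball x₀ ρ))
    refine squeeze_zero' (.of_forall fun _ => dist_nonneg) ?_ hlim
    filter_upwards [self_mem_nhdsWithin] with y hy
    have h1 := key x hx y hy _ (hfI x hx) _ (hfI y hy) (hfA x hx) (hfA y hy)
    have h2 := key y hy x hx _ (hfI y hy) _ (hfI x hx) (hfA y hy) (hfA x hx)
    rw [norm_sub_rev] at h2
    rw [Real.dist_eq, abs_le, le_div_iff₀ hr]
    exact ⟨by rw [neg_le, le_div_iff₀ hr]; linarith, h1⟩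
  -- Heights are restricted to `(-δ, δ)` because `S` is known to meet each line only once within
  -- `[-δ, δ]`.
  refine ⟨shearPartialHomeomorph v (f₀ ∘ h) (h ⁻¹' Metric.ball x₀ ρ) {x | ℓ (x - x₀) ∈ Ioo (-δ) δ}
    (Metric.isOpen_ball.preimage hcont) (isOpen_Ioo.preimage (by fun_prop))
    (fun x hx s => by rwa [mem_preimage, hhv]) (fun x _ s => by rw [Function.comp_apply, hhv]; rfl)
    hfc, ⟨?_, ?_⟩, fun x hx => ?_⟩
  · simpa [hh] using hρ
  · change ℓ (x₀ - x₀) ∈ Ioo (-δ) δ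
    simpa using hδ
  · have hxD : h x ∈ Metric.ball x₀ ρ := hx.1
    have hxI : ℓ (x - x₀) ∈ Icc (-δ) δ := Ioo_subset_Icc_self hx.2
    change x ∈ S ↔ ℓ (x + (-f₀ (h x)) • v) = ℓ x₀
    have hval : ℓ (x + (-f₀ (h x)) • v) = ℓ x₀ ↔ f₀ (h x) = ℓ (x - x₀) := by
      rw [map_add, map_smul, hℓ, map_sub, smul_eq_mul, mul_one]
      constructor <;> intro h <;> linarith
    rw [hval]
    constructor
    · intro hxA
      rw [← hxh x] at hxA
      exact huniq _ hxD _ (hfI _ hxD) _ hxI (hfA _ hxD) hxA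
    · intro hf
      rw [← hxh x, ← hf]
      exact hfA _ hxD

/-! ### Achronal sets with empty edge, and boundaries of futures and pasts. -/

namespace FoliationCocycle

variable {ι : Type*} {n q : ℕ} {M : Type*} [TopologicalSpace M]
  [ChartedSpace (RSpace n) M] [IsManifold (𝓡 n) ∞ M]
  {F : FoliationCocycle ι n q M} {Fut : ∀ x : M, Set (TangentSpace (𝓡 n) x)}

theorem ConeChart.isPiece_of_ball {i : ι} (c : ConeChart F Fut i) {p v x w : RSpace n} {r τ : ℝ}
    (hr : Metric.ball p r ⊆ c.φ.target)
    (hC : ∀ z ∈ Metric.ball p r, ∀ w ∈ Metric.ball v r, (z, w) ∈ c.C) (hτ : 0 < τ)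
    (hx : x ∈ Metric.ball p r) (hx' : x + τ • w ∈ Metric.ball p r) (hw : w ∈ Metric.ball v r) :
    IsPiece Fut (fun t => c.φ.symm (x + t • w)) 0 τ ∧
      ∀ t ∈ Icc 0 τ, c.φ.symm (x + t • w) ∈ c.φ.source := by
  have hmem : ∀ t ∈ Icc 0 τ, x + t • w ∈ Metric.ball p r := fun t ht => by
    have h := (convex_ball p r).add_smul_sub_mem hx hx' (t := t / τ)
      ⟨div_nonneg ht.1 hτ.le, (div_le_one hτ).2 ht.2⟩
    rwa [add_sub_cancel_left, smul_smul, div_mul_cancel₀ _ hτ.ne'] at h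
  exact ⟨c.isPiece_segment hτ fun t ht => ⟨hr (hmem t ht), hC _ (hmem t ht) _ hw⟩,
    fun t ht => c.φ.map_target (hr (hmem t ht))⟩

namespace LorentzMetric.TimeOrientation

variable {g : F.LorentzMetric} {T : g.TimeOrientation} {A : Set M}

/-- One straight segment serves twice: as a curve inside `W` for the edge condition, and as a
`Reach` for achronality. -/
theorem chron_of_ball {i : ι} (c : ConeChart F T.future i) {W : Set M} (hW : c.φ.source ⊆ W)
    {p v x w : RSpace n} {r τ : ℝ} (hr : Metric.ball p r ⊆ c.φ.target)
    (hC : ∀ z ∈ Metric.ball p r, ∀ w ∈ Metric.ball v r, (z, w) ∈ c.C) (hτ : 0 < τ)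
    (hx : x ∈ Metric.ball p r) (hx' : x + τ • w ∈ Metric.ball p r) (hw : w ∈ Metric.ball v r) :
    T.Chron W (F.leaf (c.φ.symm x)) (F.leaf (c.φ.symm (x + τ • w))) ∧
      Reach T.future (c.φ.symm x) (c.φ.symm (x + τ • w)) := by
  obtain ⟨h1, h2⟩ := c.isPiece_of_ball hr hC hτ hx hx' hw
  exact ⟨⟨_, 0, τ, isTimelikeCurve_of_isPiece h1, fun s hs => hW (h2 s hs), by simp, rfl⟩,
    .single ⟨_, 0, τ, h1, by simp, rfl⟩⟩

/-- A transversely achronal set without transverse edge is transversely closed. -/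
theorem isTransverselyClosed_of_edge_eq_empty (hA : T.IsAchronal A) (he : T.edge A = ∅) :
    F.IsTransverselyClosed A := by
  refine Subset.antisymm (fun x hx => ?_) (subset_transverseClosure A)
  by_contra hxA
  have hR := T.isBasicConeField.isOpenLeafRelation
  have hcl : ∀ y ∈ A, ¬ Reach T.future x y ∧ ¬ Reach T.future y x := fun y hy =>
    have hy' := subset_transverseClosure (F := F) A hy
    ⟨hR.not_rel_of_mem_transverseClosure (isAchronal_iff.1 hA) hx hy',
      hR.not_rel_of_mem_transverseClosure (isAchronal_iff.1 hA) hy' hx⟩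
  -- The witness is a short segment through `x` in a cone direction. Its other points are
  -- chronologically related to `x`, so by `hcl` none of them lies in `A`, and `x` is not in `A`
  -- either.
  have hxe : x ∈ T.edge A := by
    refine ⟨hx, fun W hW _ hxW => ?_⟩
    obtain ⟨i, hi⟩ := F.cover x
    obtain ⟨c, hc, hcW⟩ := T.isBasicConeField i x hi W (hW.mem_nhds hxW)
    obtain ⟨v, hv⟩ := c.nonempty _ (c.φ.map_source hc)
    obtain ⟨r, hr, hrt, hrC⟩ := c.exists_ball (c.φ.map_source hc) hv
    -- The `+ 1` makes the inequality strict and the denominator positive.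
    obtain ⟨δ, hδ, hδv⟩ : ∃ δ > 0, δ * ‖v‖ < r :=
      ⟨r / (‖v‖ + 1), by positivity, by
        rw [div_mul_eq_mul_div, div_lt_iff₀ (by positivity)]
        nlinarith [norm_nonneg v]⟩
    have hmem : ∀ t ∈ Icc (-δ) δ, c.φ x + t • v ∈ Metric.ball (c.φ x) r := fun t ht => by
      rw [Metric.mem_ball, dist_eq_norm, add_sub_cancel_left, norm_smul, Real.norm_eq_abs]
      exact (mul_le_mul_of_nonneg_right (abs_le.2 ht) (norm_nonneg v)).trans_lt hδv
    have hp : IsPiece T.future (fun t => c.φ.symm (c.φ x + t • v)) (-δ) δ :=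
      c.isPiece_segment (by linarith) fun t ht =>
        ⟨hrt (hmem t ht), hrC _ (hmem t ht) _ (Metric.mem_ball_self hr)⟩
    have hsub : ∀ s ∈ Icc (-δ) δ, c.φ.symm (c.φ x + s • v) ∈ W := fun s hs =>
      hcW (c.φ.map_target (hrt (hmem s hs)))
    have h0 : c.φ.symm (c.φ x + (0 : ℝ) • v) = x := by simp [c.φ.left_inv hc]
    refine ⟨_, -δ, δ, isTimelikeCurve_of_isPiece hp, hsub, ?_, ?_, fun s hs hsA => ?_⟩
    · exact mem_chronPast_leaf ⟨_, -δ, 0,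
        isTimelikeCurve_of_isPiece (hp.subinterval le_rfl (by linarith) hδ.le),
        fun s hs => hsub s ⟨hs.1, hs.2.trans hδ.le⟩, rfl, by rw [h0]⟩
    · exact mem_chronFuture_leaf ⟨_, 0, δ,
        isTimelikeCurve_of_isPiece (hp.subinterval (by linarith) hδ le_rfl),
        fun s hs => hsub s ⟨by linarith [hs.1], hs.2⟩, by rw [h0], rfl⟩
    · rcases lt_trichotomy s 0 with h | rfl | h
      · exact (hcl _ hsA).2 (.single ⟨_, s, 0, hp.subinterval hs.1 h hδ.le, rfl, h0⟩)
      · exact hxA (by rwa [h0] at hsA)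
      · exact (hcl _ hsA).1 (.single ⟨_, 0, s, hp.subinterval (by linarith) h hs.2, h0, rfl⟩)
  rw [he] at hxe
  exact hxe

/-- A transversely achronal set without transverse edge is a `C⁰` hypersurface. -/
theorem isC0Hypersurface_of_edge_eq_empty (hA : T.IsAchronal A) (he : T.edge A = ∅) :
    IsC0Hypersurface n A := by
  intro p hp
  have hach := isAchronal_iff.1 hA
  have hpe : p ∉ T.edge A := by simp [he]
  have hW : ∃ W : Set M, IsOpen W ∧ p ∈ W ∧ ∀ (α : ℝ → M) (a b : ℝ), T.IsTimelikeCurve α a b →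
      (∀ s ∈ Icc a b, α s ∈ W) → α a ∈ T.chronPast W (F.leaf ⁻¹' {F.leaf p}) →
      α b ∈ T.chronFuture W (F.leaf ⁻¹' {F.leaf p}) → ∃ s ∈ Icc a b, α s ∈ A := by
    by_contra! hcon
    refine hpe ⟨subset_transverseClosure A hp, fun W hW _ hpW => ?_⟩
    obtain ⟨α, a, b, h1, h2, h3, h4, h5⟩ := hcon W hW hpW
    exact ⟨α, a, b, h1, h2, h3, h4, h5⟩
  obtain ⟨W, hWo, hpW, hmeet⟩ := hW
  obtain ⟨i, hi⟩ := F.cover p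
  obtain ⟨c, hc, hcW⟩ := T.isBasicConeField i p hi W (hWo.mem_nhds hpW)
  set x₀ := c.φ p with hx₀
  have hx₀t : x₀ ∈ c.φ.target := c.φ.map_source hc
  have hpx₀ : c.φ.symm x₀ = p := c.φ.left_inv hc
  obtain ⟨v, hv⟩ := c.nonempty x₀ hx₀t
  have hv0 : v ≠ 0 := c.ne_zero x₀ v hx₀t hv
  obtain ⟨r, hr, hrt, hrC⟩ := c.exists_ball hx₀t hv
  obtain ⟨ℓ, hℓ⟩ : ∃ ℓ : RSpace n →L[ℝ] ℝ, ℓ v = 1 := SeparatingDual.exists_eq_one hv0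
  obtain ⟨δ, hδ, hδv⟩ : ∃ δ > 0, δ * ‖v‖ ≤ r / 2 :=
    ⟨r / 2 / ‖v‖, by positivity, by rw [div_mul_cancel₀ _ (norm_ne_zero_iff.2 hv0)]⟩
  -- The bound `r / 2` keeps the segments `y + [-δ, δ] v` in the ball. The bound `δ * r` puts `y - δ
  -- v` in the past and `y + δ v` in the future of `p`.
  obtain ⟨ρ, hρ, hρ₁, hρ₂⟩ : ∃ ρ > 0, ρ ≤ r / 2 ∧ ρ ≤ δ * r :=
    ⟨min (r / 2) (δ * r), lt_min (by positivity) (by positivity), min_le_left _ _, min_le_right _ _⟩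
  have hball : ∀ y ∈ Metric.ball x₀ ρ, ∀ t ∈ Icc (-δ) δ, y + t • v ∈ Metric.ball x₀ r := by
    intro y hy t ht
    have h1 : ‖y - x₀‖ < r / 2 := (mem_ball_iff_norm.1 hy).trans_le hρ₁
    have h2 : ‖t • v‖ ≤ r / 2 := by
      rw [norm_smul, Real.norm_eq_abs]
      exact (mul_le_mul_of_nonneg_right (abs_le.2 ht) (norm_nonneg v)).trans hδv
    rw [mem_ball_iff_norm, add_sub_right_comm]
    linarith [norm_add_le (y - x₀) (t • v)]
  have hvel : ∀ (z : RSpace n) (τ : ℝ), 0 < τ → ‖z‖ < τ * r → v + τ⁻¹ • z ∈ Metric.ball v r :=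
    fun z τ hτ hz => by
      rwa [mem_ball_iff_norm, add_sub_cancel_left, norm_smul, norm_inv,
        Real.norm_of_nonneg hτ.le, inv_mul_lt_iff₀ hτ]
  have hchron : ∀ y z : RSpace n, ∀ s t : ℝ, y + s • v ∈ Metric.ball x₀ r →
      z + t • v ∈ Metric.ball x₀ r → 0 < t - s → ‖z - y‖ < (t - s) * r →
      T.Chron W (F.leaf (c.φ.symm (y + s • v))) (F.leaf (c.φ.symm (z + t • v))) ∧
        Reach T.future (c.φ.symm (y + s • v)) (c.φ.symm (z + t • v)) := by
    intro y z s t hy hz hτ hyz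
    -- The displacement is `t - s` times a vector within `r` of `v`, hence in the cones.
    have e : y + s • v + (t - s) • (v + (t - s)⁻¹ • (z - y)) = z + t • v := by
      rw [smul_add, smul_inv_smul₀ hτ.ne']
      module
    have := chron_of_ball c hcW hrt hrC hτ hy (by rwa [e]) (hvel (z - y) _ hτ hyz)
    rwa [e] at this
  have hex : ∀ y ∈ Metric.ball x₀ ρ, ∃ t ∈ Icc (-δ) δ, y + t • v ∈ c.φ.symm ⁻¹' A := by
    intro y hy
    have hpc : IsPiece T.future (fun t => c.φ.symm (y + t • v)) (-δ) δ :=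
      c.isPiece_segment (by linarith) fun t ht =>
        ⟨hrt (hball y hy t ht), hrC _ (hball y hy t ht) _ (Metric.mem_ball_self hr)⟩
    have hn : ‖y - x₀‖ < δ * r := (mem_ball_iff_norm.1 hy).trans_le hρ₂
    have e : x₀ + (0 : ℝ) • v = x₀ := by simp
    have hx₀r : x₀ + (0 : ℝ) • v ∈ Metric.ball x₀ r := by
      rw [e]
      exact Metric.mem_ball_self hr
    refine hmeet _ _ _ (isTimelikeCurve_of_isPiece hpc)
      (fun s hs => hcW (c.φ.map_target (hrt (hball y hy s hs)))) (mem_chronPast_leaf ?_)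
      (mem_chronFuture_leaf ?_)
    · have := (hchron y x₀ (-δ) 0 (hball y hy _ ⟨le_rfl, by linarith⟩) hx₀r (by linarith)
        (by rwa [norm_sub_rev, zero_sub, neg_neg])).1
      rwa [e, hpx₀] at this
    · have := (hchron x₀ y 0 δ hx₀r (hball y hy _ ⟨by linarith, le_rfl⟩) (by linarith)
        (by rwa [sub_zero])).1
      rwa [e, hpx₀] at this
  -- A violation of the Lipschitz bound would put the two points of `A` in chronological relation.
  obtain ⟨e, hxe, he⟩ := exists_graph_chart hr hδ hρ hℓ hex fun y hy z hz s hs t ht hyA hzA => by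
    by_contra! hlt
    have hτ : 0 < t - s := pos_of_mul_pos_left ((norm_nonneg _).trans_lt hlt) hr.le
    exact hach _ hyA _ hzA (hchron y z s t (hball y hy s hs) (hball z hz t ht) hτ hlt).2
  refine ⟨c.φ.trans e, ⟨hc, hxe⟩, ℓ, ℓ x₀, fun h0 => by simp [h0] at hℓ, fun y hy => ?_⟩
  have := he (c.φ y) hy.2
  rwa [mem_preimage, c.φ.left_inv hy.1] at this

/-- It is enough to test the edge condition on the whole manifold. The alternative in `hR` covers
futures and pasts at once; in the reversed case the two ends of the curve exchange roles. -/
theorem edge_eq_empty_of_frontier {R : M → M → Prop} (h : IsOpenLeafRelation F R)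
    (hR : (∀ x y, Reach T.future x y → R x y) ∨ ∀ x y, Reach T.future x y → R y x) (A : Set M) :
    T.edge (frontier {y | ∃ x ∈ A, R x y}) = ∅ := by
  rw [eq_empty_iff_forall_notMem]
  rintro x ⟨hx, hW⟩
  obtain ⟨α, a, b, hα, -, ha, hb, hAα⟩ := hW univ isOpen_univ
    ((F.isSaturated_iff _).2 fun _ _ _ _ => mem_univ _) (mem_univ _)
  rw [chronPast_univ] at ha
  rw [chronFuture_univ] at hb
  obtain ⟨x₁, hx₁, hax⟩ := ha
  obtain ⟨x₂, hx₂, hxb⟩ := hb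
  rw [T.isBasicConeField.reach_congr_right hx₁] at hax
  rw [T.isBasicConeField.reach_congr_left hx₂] at hxb
  have hS : IsPreconnected (α '' Icc a b) :=
    isPreconnected_Icc.image α hα.continuousOn_and_reach.1
  have haS : α a ∈ α '' Icc a b := mem_image_of_mem α (left_mem_Icc.2 hα.1.le)
  have hbS : α b ∈ α '' Icc a b := mem_image_of_mem α (right_mem_Icc.2 hα.1.le)
  obtain ⟨_, ⟨s, hs, rfl⟩, hsA⟩ : (α '' Icc a b ∩ frontier {y | ∃ x ∈ A, R x y}).Nonempty := by
    rcases hR with hR | hR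
    · exact h.inter_frontier_nonempty hx hS haS hbS (hR _ _ hax) (hR _ _ hxb)
    · exact h.inter_frontier_nonempty hx hS hbS haS (hR _ _ hxb) (hR _ _ hax)
  exact hAα s hs hsA

end LorentzMetric.TimeOrientation

end FoliationCocycle

theorem theorem4p35 {ι : Type*} {n q : ℕ} (hq : 2 ≤ q) (hqn : q < n)
    {M : Type*} [TopologicalSpace M] [T2Space M] [SecondCountableTopology M] [ConnectedSpace M]
    [ChartedSpace (RSpace n) M] [IsManifold (𝓡 n) ∞ M]
    (F : FoliationCocycle ι n q M) (g : F.LorentzMetric) (T : g.TimeOrientation) :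
    (∀ A : Set M, T.IsAchronal A → T.edge A = ∅ →
      F.IsTransverselyClosed A ∧ F.IsSaturated A ∧ IsC0Hypersurface n A) ∧
    (∀ A : Set M, F.IsSaturated A →
      ∀ B : Set M, B = frontier (T.chronFuture univ A) ∨ B = frontier (T.chronPast univ A) →
        T.IsAchronal B ∧ T.edge B = ∅ ∧
        F.IsTransverselyClosed B ∧ F.IsSaturated B ∧ IsC0Hypersurface n B) := by
  have part1 : ∀ A : Set M, T.IsAchronal A → T.edge A = ∅ →
      F.IsTransverselyClosed A ∧ F.IsSaturated A ∧ IsC0Hypersurface n A := fun A hA he =>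
    have hcl :=
      FoliationCocycle.LorentzMetric.TimeOrientation.isTransverselyClosed_of_edge_eq_empty hA he
    ⟨hcl, FoliationCocycle.isSaturated_of_isTransverselyClosed hcl,
      FoliationCocycle.LorentzMetric.TimeOrientation.isC0Hypersurface_of_edge_eq_empty hA he⟩
  have hR := T.isBasicConeField.isOpenLeafRelation
  refine ⟨part1, fun A _ B hB => ?_⟩
  have hBB : T.IsAchronal B ∧ T.edge B = ∅ := by
    rcases hB with rfl | rfl
    · rw [FoliationCocycle.LorentzMetric.TimeOrientation.chronFuture_univ]
      exact ⟨FoliationCocycle.LorentzMetric.TimeOrientation.isAchronal_iff.2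
          fun x hx y hy => hR.not_rel_of_mem_frontier hx hy,
        FoliationCocycle.LorentzMetric.TimeOrientation.edge_eq_empty_of_frontier hR
          (.inl fun _ _ => id) A⟩
    · rw [FoliationCocycle.LorentzMetric.TimeOrientation.chronPast_univ]
      exact ⟨FoliationCocycle.LorentzMetric.TimeOrientation.isAchronal_iff.2
          fun x hx y hy => hR.swap.not_rel_of_mem_frontier hy hx,
        FoliationCocycle.LorentzMetric.TimeOrientation.edge_eq_empty_of_frontier hR.swap
          (.inr fun _ _ => id) A⟩
  exact ⟨hBB.1, hBB.2, part1 B hBB.1 hBB.2⟩
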